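/- **Theorem.** Consider the analytic saddle-node $$\dot x = x^2,\qquad \dot y=-y(1+a^0x)+g^0(x,y),\qquad g^0(x,y)=\sum_{k\ge 2} f_k^0x^k+\mu\sum_{k\ge 1}\sum_{l\ge 2}h^0_{k,l}x^ky^l .$$ Fix $B,\rho>0$, a compact interval $A\subset(-2,\infty)$ and a compact interval $I$ (both nondegenerate) with $|t|\le B\rho^{-2}$ for all $t\in I$. A *center manifold* is a local $C^\infty$ invariant graph $y=m^0(x)$ with $m^0(0)=\frac{dm^0}{dx}(0)=0$, i.e. near $x=0$ $$x^2\,\frac{dm^0}{dx}(x)=-m^0(x)(1+a^0x)+g^0(x,m^0(x)),$$ and $\widehat m^0(x)=\sum_{k\ge2}m_k^0x^k$ denotes the formal power series solution of this equation. There are $\mu_0>0$ and $K$, depending only on $A,B,\rho,I$, and a number $S_\infty^0$ depending only on $a^0$ and on the full jet of $g^0$, such that for all $a^0\in A$, $0\le\mu<\mu_0$ and all real coefficients with $$|f_k^0|\le B\rho^{-k}\ (k\ge2),\qquad |h^0_{k,l}|\le\rho^{-k-l}\ (k\ge1,\ l\ge2)$$ the following holds. 1. (a) The formal solution $\widehat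 m^0$ exists, is unique, and $\dfrac{(-1)^k m_k^0}{\Gamma(k+a^0)}\to S_\infty^0$ as $k\to\infty$. Likewise, for every center manifold $m^0$, $$\frac{(-1)^k}{\Gamma(k+a^0)}\,\frac1{k!}\,\frac{d^km^0}{dx^k}(0)\to S_\infty^0\qquad(k\to\infty).$$ (b) If $S_\infty^0\ne0$, then every center manifold $m^0$ is nonanalytic at $x=0$. 2. With all other coefficients fixed, $S_\infty^0$ is a $C^1$-function of $f_2^0\in I$, and for all $f_2^0\in I$ $$\left|\frac{\partial S_\infty^0}{\partial f_2^0}(f_2^0)-\frac1{\Gamma(2+a^0)}\right|\le K\mu,\qquad \frac{\partial S_\infty^0}{\partial f_2^0}(f_2^0)\ne0 .$$ Moreover $S_\infty^0$ is a $C^1$-function of all parameters of the system jointly: it is $C^1$ in the sense of Fréchet in $\big(a^0,\mu,(\rho^kf^0_k)_k,(\rho^{k+l}h^0_{k,l})_{k,l}\big)$ on $A\times[0,\mu_0)\times\{\|\cdot\|_{\infty}\le B\}\times\{\|\cdot\|_\infty\le1\}\subset\mathbb R\times\mathbb R\times\ell^\infty\times\ell^\infty$. -/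

import Mathlib

namespace SaddleNode

open scoped PowerSeries ContDiff ENNReal

/-- The nonlinearity `g(x,y) = f(x) + u(x,y)` with
`f(x) = ∑_{k ≥ 2} f_k x^k` and `u(x,y) = ∑_{k ≥ 1, l ≥ 2} u_{k,l} x^k y^l`.
The entries `f 0`, `f 1`, `u 0 l`, `u k 0`, `u k 1` are never used. -/
noncomputable def nonlinearity (f : ℕ → ℝ) (u : ℕ → ℕ → ℝ) (x y : ℝ) : ℝ :=
  (∑' k : ℕ, f (k + 2) * x ^ (k + 2)) +
    ∑' p : ℕ × ℕ, u (p.1 + 1) (p.2 + 2) * x ^ (p.1 + 1) * y ^ (p.2 + 2)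

/-- `y = m(x)` is a (smooth, local) center manifold at the origin of the saddle-node
`x' = x^2`, `y' = -y (1 + a x) + g(x,y)`: its graph contains the origin, is tangent there to `y = 0`,
and is invariant near the origin, i.e. `m'(x) x^2 = -m(x) (1 + a x) + g(x, m(x))` for `x` near `0`. -/
structure IsCenterManifold (a : ℝ) (f : ℕ → ℝ) (u : ℕ → ℕ → ℝ) (m : ℝ → ℝ) : Prop where
  smooth : ContDiffAt ℝ ∞ m 0
  map_zero : m 0 = 0
  deriv_zero : deriv m 0 = 0
  invariant : ∀ᶠ x in nhds (0 : ℝ),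
    x ^ 2 * deriv m x = -m x * (1 + a * x) + nonlinearity f u x (m x)

/-- The formal power series `g(x, φ(x))`, for `φ` without constant term. Its `n`-th coefficient only
involves the indices `k, l ≤ n`, because the series `X^k φ^l` has order at least `k + l`. -/
noncomputable def formalNonlinearity (f : ℕ → ℝ) (u : ℕ → ℕ → ℝ) (φ : ℝ⟦X⟧) : ℝ⟦X⟧ :=
  PowerSeries.mk fun n =>
    (if 2 ≤ n then f n else 0) +
      ∑ k ∈ Finset.Icc 1 n, ∑ l ∈ Finset.Icc 2 n,
        u k l * PowerSeries.coeff n ((PowerSeries.X : ℝ⟦X⟧) ^ k * φ ^ l)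

/-- `φ = ∑_{k ≥ 2} m_k x^k` is a formal solution of the invariance equation
`x^2 φ' + φ (1 + a x) = g(x, φ)`, i.e. the formal expansion of the center manifold. -/
structure IsFormalCenterManifold (a : ℝ) (f : ℕ → ℝ) (u : ℕ → ℕ → ℝ) (φ : ℝ⟦X⟧) : Prop where
  coeff_zero : PowerSeries.coeff 0 φ = 0
  coeff_one : PowerSeries.coeff 1 φ = 0
  invariant :
    (PowerSeries.X : ℝ⟦X⟧) ^ 2 * PowerSeries.derivative ℝ φ +
        φ * (1 + PowerSeries.C a * PowerSeries.X) =
      formalNonlinearity f u φ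

/-- The bounds `|f_k| ≤ B ρ^{-k}` (`k ≥ 2`) and `|h_{k,l}| ≤ ρ^{-k-l}` (`k ≥ 1`, `l ≥ 2`). -/
structure Admissible (ρ B : ℝ) (f : ℕ → ℝ) (h : ℕ → ℕ → ℝ) : Prop where
  f_bound : ∀ k, 2 ≤ k → |f k| ≤ B * (ρ ^ k)⁻¹
  h_bound : ∀ k l, 1 ≤ k → 2 ≤ l → |h k l| ≤ (ρ ^ (k + l))⁻¹

/-- The Banach space of all parameters `(a, μ, (ρ^k f_k)_k, (ρ^{k+l} h_{k,l})_{k,l})`; the two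
sequences of rescaled coefficients are bounded and carry the supremum norm. -/
abbrev Parameters : Type :=
  ℝ × ℝ × lp (fun _ : ℕ => ℝ) ∞ × lp (fun _ : ℕ × ℕ => ℝ) ∞

end SaddleNode

namespace SaddleNode

open scoped PowerSeries ContDiff ENNReal
open Finset

/-! Put `φ = X ^ 2 * χ` and `b = a + 2`. Comparing coefficients, the invariance equation becomes
`χ_K + (b + K - 1) χ_{K-1} = f_{K+2} + I_K(χ)`, where the interaction `I_K` involves only earlier
coefficients; this gives existence and uniqueness. Dividing by `(-1)^K b (b+1) ⋯ (b+K-1)` makes the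
recursion telescope: the normalized coefficient `(-1)^K χ_K / rise b K` is a partial sum of
`summand` (`sum_summand`). As `Γ(b+K) = rise b K * Γ(b)`, the number `S` is `1/Γ(b)` times the sum
of that series.

Convergence rests on an a priori bound `|χ_K| ≤ M |rise b K|`. Rising factorials are
supermultiplicative, so powers of `χ` satisfy the same bound up to powers of `K + 1`. The factor `X
^ (p + 2l + 3)` accompanying `χ ^ (l + 2)` lowers the index enough to absorb these powers and to
gain `1 / (p! l! (K+1)^2)` (`le_prod_add`, `norm_interaction_le`). For small `μ` the bound thus
reproduces itself along the iteration (`norm_coeff_iter_le`), and the series has a majorant uniform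
in the parameters.

All estimates hold for complex parameters with `Re b ≥ δ > 0`. Each summand is holomorphic, so
Cauchy estimates turn uniform bounds into `C^1` dependence. In the variable `f_2` the series is
`f_2`, plus a constant, plus a nonlinear part of size `O(μ)` on a disc; its derivative is `O(μ)` as
well.

For a center manifold, the Taylor series at `0` is a formal solution, hence the same series. If the
manifold were analytic, its coefficients would grow at most geometrically, and division by `Γ(k +
a)` would force `S = 0`. -/

noncomputable section

/-! ### The formal solution as an `X`-adic fixed point -/

variable {R : Type*} [CommRing R]

/-- For `φ = X ^ 2 * χ`, the coefficient of `X ^ (K + 2)` in `∑ u_{k,l} X ^ k φ ^ l`. -/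
def interaction (u : ℕ → ℕ → R) (χ : R⟦X⟧) (K : ℕ) : R :=
  ∑ p ∈ range (K + 2), ∑ l ∈ range (K + 1),
    u (p + 1) (l + 2) * PowerSeries.coeff K (PowerSeries.X ^ (p + 2 * l + 3) * χ ^ (l + 2))

/-- The invariance equation for `φ = X ^ 2 * χ`, with `b = a + 2`, is the fixed point equation
of this map. -/
def step (b : R) (f : ℕ → R) (u : ℕ → ℕ → R) (χ : R⟦X⟧) : R⟦X⟧ :=
  PowerSeries.mk fun K =>
    f (K + 2) + interaction u χ K - (b + K - 1) * PowerSeries.coeff K (PowerSeries.X * χ)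

/-- The iterates of `step`, starting from `0`. -/
def iter (b : R) (f : ℕ → R) (u : ℕ → ℕ → R) : ℕ → R⟦X⟧
  | 0 => 0
  | N + 1 => step b f u (iter b f u N)

/-- The fixed point of `step`. -/
def sol (b : R) (f : ℕ → R) (u : ℕ → ℕ → R) : R⟦X⟧ :=
  PowerSeries.mk fun K => PowerSeries.coeff K (iter b f u (K + 1))

theorem coeff_eq_of_X_pow_dvd_sub {χ ψ : R⟦X⟧} {n : ℕ} (h : PowerSeries.X ^ n ∣ χ - ψ) {m : ℕ}
    (hm : m < n) : PowerSeries.coeff m χ = PowerSeries.coeff m ψ := by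
  have := PowerSeries.X_pow_dvd_iff.1 h m hm
  rwa [map_sub, sub_eq_zero] at this

theorem interaction_congr (u : ℕ → ℕ → R) {χ ψ : R⟦X⟧} {n K : ℕ}
    (h : PowerSeries.X ^ n ∣ χ - ψ) (hK : K < n + 3) :
    interaction u χ K = interaction u ψ K := by
  refine sum_congr rfl fun p _ => sum_congr rfl fun l _ => ?_
  congr 1
  refine coeff_eq_of_X_pow_dvd_sub (n := n + 3) ?_ hK
  rw [← mul_sub, pow_add, mul_comm]
  exact mul_dvd_mul ((pow_dvd_pow _ (by omega : 3 ≤ p + 2 * l + 3)))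
    (h.trans (sub_dvd_pow_sub_pow _ _ _))

/-- `step` is an `X`-adic contraction: the source cancels in the difference, the linear term carries
a factor `X`, and the interaction carries at least `X ^ 3`. -/
theorem X_pow_dvd_step_sub (b : R) (f : ℕ → R) (u : ℕ → ℕ → R) {χ ψ : R⟦X⟧} {n : ℕ}
    (h : PowerSeries.X ^ n ∣ χ - ψ) :
    PowerSeries.X ^ (n + 1) ∣ step b f u χ - step b f u ψ := by
  refine PowerSeries.X_pow_dvd_iff.2 fun m hm => ?_
  have h1 : PowerSeries.coeff m (PowerSeries.X * χ) = PowerSeries.coeff m (PowerSeries.X * ψ) := by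
    refine coeff_eq_of_X_pow_dvd_sub (n := n + 1) ?_ hm
    rw [← mul_sub, pow_succ']
    exact mul_dvd_mul_left _ h
  simp [step, h1, interaction_congr u h (by omega : m < n + 3)]

theorem X_pow_dvd_iter_sub (b : R) (f : ℕ → R) (u : ℕ → ℕ → R) (N : ℕ) :
    PowerSeries.X ^ N ∣ iter b f u (N + 1) - iter b f u N := by
  induction N with
  | zero => simp
  | succ N ih => exact X_pow_dvd_step_sub b f u ih

theorem coeff_iter (b : R) (f : ℕ → R) (u : ℕ → ℕ → R) {m N : ℕ} (h : m < N) :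
    PowerSeries.coeff m (iter b f u N) = PowerSeries.coeff m (sol b f u) := by
  induction N, h using Nat.le_induction with
  | base => simp [sol]
  | succ N hN ih =>
    rw [← ih]
    exact coeff_eq_of_X_pow_dvd_sub (X_pow_dvd_iter_sub b f u N) hN

theorem X_pow_dvd_sol_sub (b : R) (f : ℕ → R) (u : ℕ → ℕ → R) (N : ℕ) :
    PowerSeries.X ^ N ∣ sol b f u - iter b f u N :=
  PowerSeries.X_pow_dvd_iff.2 fun m hm => by simp [coeff_iter b f u hm]

theorem step_sol (b : R) (f : ℕ → R) (u : ℕ → ℕ → R) : step b f u (sol b f u) = sol b f u := by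
  ext m
  have h := X_pow_dvd_step_sub b f u (X_pow_dvd_sol_sub b f u m)
  rw [coeff_eq_of_X_pow_dvd_sub h (Nat.lt_succ_self m)]
  exact coeff_iter b f u (Nat.lt_succ_self m)

theorem eq_sol_of_step_eq {b : R} {f : ℕ → R} {u : ℕ → ℕ → R} {χ : R⟦X⟧}
    (h : step b f u χ = χ) : χ = sol b f u := by
  have key : ∀ N, PowerSeries.X ^ N ∣ χ - sol b f u := by
    intro N
    induction N with
    | zero => simp
    | succ N ih =>
      rw [← h, ← step_sol]
      exact X_pow_dvd_step_sub b f u ih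
  ext m
  exact coeff_eq_of_X_pow_dvd_sub (key (m + 1)) (Nat.lt_succ_self m)

theorem coeff_zero_sol (b : R) (f : ℕ → R) (u : ℕ → ℕ → R) :
    PowerSeries.coeff 0 (sol b f u) = f 2 + interaction u (sol b f u) 0 := by
  conv_lhs => rw [← step_sol]
  simp [step]

theorem coeff_succ_sol (b : R) (f : ℕ → R) (u : ℕ → ℕ → R) (K : ℕ) :
    PowerSeries.coeff (K + 1) (sol b f u) =
      f (K + 3) + interaction u (sol b f u) (K + 1) -
        (b + K) * PowerSeries.coeff K (sol b f u) := by
  conv_lhs => rw [← step_sol]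
  simp [step, PowerSeries.coeff_succ_X_mul, add_sub_assoc]

theorem map_interaction {R' : Type*} [CommRing R'] (σ : R →+* R') (u : ℕ → ℕ → R) (χ : R⟦X⟧)
    (K : ℕ) : σ (interaction u χ K) =
      interaction (fun k l => σ (u k l)) (PowerSeries.map σ χ) K := by
  simp only [interaction, map_sum, map_mul]
  refine sum_congr rfl fun p _ => sum_congr rfl fun l _ => ?_
  rw [← PowerSeries.coeff_map]
  simp

theorem map_step {R' : Type*} [CommRing R'] (σ : R →+* R') (b : R) (f : ℕ → R) (u : ℕ → ℕ → R)
    (χ : R⟦X⟧) : PowerSeries.map σ (step b f u χ) =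
      step (σ b) (fun k => σ (f k)) (fun k l => σ (u k l)) (PowerSeries.map σ χ) := by
  ext K
  simp only [step, PowerSeries.coeff_map, PowerSeries.coeff_mk, map_sub, map_add, map_mul,
    map_interaction, map_natCast, map_one]
  rw [← PowerSeries.coeff_map, map_mul, PowerSeries.map_X]

/-- The image of the solution is a fixed point of the transported `step`, and fixed points are
unique. Applied to `ℝ → ℂ`, this carries the complex estimates back to real systems. -/
theorem map_sol {R' : Type*} [CommRing R'] (σ : R →+* R') (b : R) (f : ℕ → R) (u : ℕ → ℕ → R) :
    PowerSeries.map σ (sol b f u) =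
      sol (σ b) (fun k => σ (f k)) (fun k l => σ (u k l)) :=
  eq_sol_of_step_eq (by rw [← map_step, step_sol])

theorem coeff_formalNonlinearity_X_sq_mul (f : ℕ → ℝ) (u : ℕ → ℕ → ℝ) (χ : ℝ⟦X⟧) (K : ℕ) :
    PowerSeries.coeff (K + 2) (formalNonlinearity f u (PowerSeries.X ^ 2 * χ)) =
      f (K + 2) + interaction u χ K := by
  simp only [formalNonlinearity, PowerSeries.coeff_mk, le_add_iff_nonneg_left, zero_le, if_true,
    interaction]
  congr 1
  rw [show Icc 1 (K + 2) = Ico 1 (K + 3) by ext; simp; omega,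
    show Icc 2 (K + 2) = Ico 2 (K + 3) by ext; simp; omega, sum_Ico_eq_sum_range]
  refine sum_congr (by simp) fun p _ => ?_
  rw [sum_Ico_eq_sum_range]
  refine sum_congr (by simp) fun l _ => ?_
  rw [add_comm 1 p, add_comm 2 l]
  congr 1
  rw [show (PowerSeries.X : ℝ⟦X⟧) ^ (p + 1) * (PowerSeries.X ^ 2 * χ) ^ (l + 2) =
    PowerSeries.X ^ 2 * (PowerSeries.X ^ (p + 2 * l + 3) * χ ^ (l + 2)) by ring,
    PowerSeries.coeff_X_pow_mul]

/-- The coefficient of `X ^ (K + 2)` in the invariance equation is exactly the recursion encoded by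
`step`; the coefficients of order `0` and `1` vanish on both sides. -/
theorem isFormalCenterManifold_iff (a : ℝ) (f : ℕ → ℝ) (u : ℕ → ℕ → ℝ) (φ : ℝ⟦X⟧) :
    IsFormalCenterManifold a f u φ ↔ φ = PowerSeries.X ^ 2 * sol (a + 2) f u := by
  have lhs : ∀ χ : ℝ⟦X⟧, ∀ K : ℕ, PowerSeries.coeff (K + 2)
      ((PowerSeries.X : ℝ⟦X⟧) ^ 2 * PowerSeries.derivative ℝ (PowerSeries.X ^ 2 * χ) +
        PowerSeries.X ^ 2 * χ * (1 + PowerSeries.C a * PowerSeries.X)) =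
      PowerSeries.coeff K χ + (a + 2 + K - 1) * PowerSeries.coeff K (PowerSeries.X * χ) := by
    intro χ K
    rw [map_add, PowerSeries.coeff_X_pow_mul, PowerSeries.coeff_derivative,
      show (PowerSeries.X : ℝ⟦X⟧) ^ 2 * χ = PowerSeries.X * (PowerSeries.X * χ) by ring,
      PowerSeries.coeff_succ_X_mul,
      show (PowerSeries.X : ℝ⟦X⟧) * (PowerSeries.X * χ) * (1 + PowerSeries.C a * PowerSeries.X) =
      PowerSeries.X ^ 2 * (χ + PowerSeries.C a * (PowerSeries.X * χ)) by ring,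
      PowerSeries.coeff_X_pow_mul, map_add, PowerSeries.coeff_C_mul]
    ring
  constructor
  · intro h
    obtain ⟨χ, rfl⟩ : PowerSeries.X ^ 2 ∣ φ := by
      refine PowerSeries.X_pow_dvd_iff.2 fun m hm => ?_
      interval_cases m
      exacts [h.coeff_zero, h.coeff_one]
    congr 1
    refine eq_sol_of_step_eq ?_
    ext K
    have := congrArg (PowerSeries.coeff (K + 2)) h.invariant
    rw [lhs, coeff_formalNonlinearity_X_sq_mul] at this
    simp only [step, PowerSeries.coeff_mk]
    linarith
  · rintro rfl
    refine ⟨by simp [PowerSeries.coeff_X_pow_mul'], by simp [PowerSeries.coeff_X_pow_mul'], ?_⟩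
    ext n
    match n with
    | 0 => simp [formalNonlinearity]
    | 1 =>
      simp [formalNonlinearity, mul_assoc, PowerSeries.coeff_X_pow_mul']
    | K + 2 =>
      rw [lhs, coeff_formalNonlinearity_X_sq_mul]
      have := congrArg (PowerSeries.coeff K) (step_sol (a + 2) f u)
      simp only [step, PowerSeries.coeff_mk] at this
      linarith

/-! ### Rising factorials and the bound for the interaction terms -/

/-- The rising factorial `b (b + 1) ⋯ (b + K - 1) = Γ(b + K) / Γ(b)`. -/
def rise {R : Type*} [CommRing R] (b : R) (K : ℕ) : R := ∏ i ∈ range K, (b + i)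

theorem rise_succ {R : Type*} [CommRing R] (b : R) (K : ℕ) :
    rise b (K + 1) = rise b K * (b + K) := prod_range_succ _ _

theorem rise_add {R : Type*} [CommRing R] (b : R) (i j : ℕ) :
    rise b (i + j) = rise b i * ∏ q ∈ range j, (b + i + q) := by
  simp [rise, prod_range_add, add_assoc]

theorem map_rise {R R' : Type*} [CommRing R] [CommRing R'] (σ : R →+* R') (b : R) (K : ℕ) :
    σ (rise b K) = rise (σ b) K := by
  simp [rise]

theorem norm_le_norm_add_of_re_nonneg {z : ℂ} (hz : 0 ≤ z.re) {r : ℝ} (hr : 0 ≤ r) :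
    ‖z‖ ≤ ‖z + r‖ := by
  rw [Complex.norm_def, Complex.norm_def]
  apply Real.sqrt_le_sqrt
  simp only [Complex.normSq_apply, Complex.add_re, Complex.ofReal_re, Complex.add_im,
    Complex.ofReal_im, add_zero]
  nlinarith

/-- Shifting each factor `b + q` of `rise b j` to the right by `i` does not decrease its modulus
when `Re b ≥ 0`. -/
theorem norm_rise_mul_le {b : ℂ} (hb : 0 ≤ b.re) (i j : ℕ) :
    ‖rise b i‖ * ‖rise b j‖ ≤ ‖rise b (i + j)‖ := by
  rw [rise_add, norm_mul]
  gcongr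
  rw [rise, norm_prod, norm_prod]
  refine prod_le_prod (fun _ _ => norm_nonneg _) fun q _ => ?_
  have := norm_le_norm_add_of_re_nonneg (z := b + q) (by simp; positivity) (Nat.cast_nonneg i)
  refine this.trans_eq ?_
  congr 1
  push_cast
  ring

/-- Each further factor `χ` costs only the number `n + 1` of terms of the Cauchy product, by
`norm_rise_mul_le`. -/
theorem norm_coeff_pow_le {b : ℂ} (hb : 0 ≤ b.re) {χ : ℂ⟦X⟧} {M : ℝ} (hM : 0 ≤ M)
    (h : ∀ n, ‖PowerSeries.coeff n χ‖ ≤ M * ‖rise b n‖) (l n : ℕ) :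
    ‖PowerSeries.coeff n (χ ^ (l + 1))‖ ≤ M ^ (l + 1) * ((n : ℝ) + 1) ^ l * ‖rise b n‖ := by
  induction l generalizing n with
  | zero => simpa using h n
  | succ l ih =>
    rw [pow_succ, PowerSeries.coeff_mul]
    calc ‖∑ p ∈ antidiagonal n, PowerSeries.coeff p.1 (χ ^ (l + 1)) * PowerSeries.coeff p.2 χ‖
        ≤ ∑ p ∈ antidiagonal n, M ^ (l + 2) * ((n : ℝ) + 1) ^ l * ‖rise b n‖ := by
          refine norm_sum_le_of_le _ fun p hp => ?_
          obtain rfl := mem_antidiagonal.1 hp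
          rw [norm_mul]
          calc _ ≤ (M ^ (l + 1) * ((p.1 : ℝ) + 1) ^ l * ‖rise b p.1‖) * (M * ‖rise b p.2‖) := by
                gcongr
                exacts [ih _, h _]
            _ = M ^ (l + 2) * ((p.1 : ℝ) + 1) ^ l * (‖rise b p.1‖ * ‖rise b p.2‖) := by ring
            _ ≤ _ := by
                gcongr
                · simp
                · exact norm_rise_mul_le hb _ _
      _ = _ := by
          simp only [sum_const, Nat.card_antidiagonal, nsmul_eq_mul]
          push_cast
          ring

/-- The `p + 2l + 3` factors are shared out: the first gives `δ (n + 1)`, the next `l` give `(n + 1)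
^ l`, the next `p + l` give `(p + l)! ≥ p! l!`, and the last two give the square. The constant `8`
is sharp for these two at `n = p = l = 0`, where they equal `1 * 2 = 4 ^ 2 / 8`. -/
theorem le_prod_add {δ : ℝ} (hδ : 0 < δ) (hδ1 : δ ≤ 1) (n p l : ℕ) :
    δ / 8 * ((n + (p + 2 * l + 3) : ℕ) + 1 : ℝ) ^ 2 * ((n : ℝ) + 1) ^ (l + 1) *
      (p.factorial * l.factorial) ≤ ∏ q ∈ range (p + 2 * l + 3), (δ + n + q) := by
  have h0 : δ * (n + 1) ≤ δ + n := by nlinarith [(Nat.cast_nonneg n : (0:ℝ) ≤ n)]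
  have h1 : ∏ q ∈ range (p + 2 * l + 2), ((n : ℝ) + 1 + q) ≤
      ∏ q ∈ range (p + 2 * l + 2), (δ + n + (q + 1 : ℕ)) := by
    refine prod_le_prod (fun _ _ => by positivity) fun q _ => ?_
    push_cast
    linarith
  have h2 : ∏ q ∈ range (p + 2 * l + 2), ((n : ℝ) + 1 + q) =
      (∏ q ∈ range l, ((n : ℝ) + 1 + q)) * (∏ q ∈ range (p + l), ((n : ℝ) + 1 + (l + q : ℕ))) *
        (((n : ℝ) + 1 + (p + 2 * l : ℕ)) * ((n : ℝ) + 1 + (p + 2 * l + 1 : ℕ))) := by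
    rw [prod_range_succ, prod_range_succ, show p + 2 * l = l + (p + l) by ring, prod_range_add]
    ring
  have h3 : ((n : ℝ) + 1) ^ l ≤ ∏ q ∈ range l, ((n : ℝ) + 1 + q) := by
    rw [← card_range l, ← prod_const]
    simp only [card_range]
    exact prod_le_prod (fun _ _ => by positivity) fun q _ => by simp
  have h4 : (p.factorial * l.factorial : ℝ) ≤
      ∏ q ∈ range (p + l), ((n : ℝ) + 1 + (l + q : ℕ)) := by
    have : ((p + l).factorial : ℝ) ≤ ∏ q ∈ range (p + l), ((n : ℝ) + 1 + (l + q : ℕ)) := by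
      rw [← prod_range_add_one_eq_factorial, Nat.cast_prod]
      refine prod_le_prod (fun _ _ => by positivity) fun q _ => ?_
      push_cast
      linarith [(Nat.cast_nonneg n : (0:ℝ) ≤ n), (Nat.cast_nonneg l : (0:ℝ) ≤ l)]
    refine le_trans ?_ this
    exact_mod_cast Nat.le_of_dvd (Nat.factorial_pos _) (Nat.factorial_mul_factorial_dvd_factorial_add p l)
  have h5 : ((n + (p + 2 * l + 3) : ℕ) + 1 : ℝ) ^ 2 / 8 ≤
      ((n : ℝ) + 1 + (p + 2 * l : ℕ)) * ((n : ℝ) + 1 + (p + 2 * l + 1 : ℕ)) := by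
    have : (0 : ℝ) ≤ n + (p + 2 * l) := by positivity
    push_cast
    nlinarith
  rw [prod_range_succ']
  calc _ = (((n : ℝ) + 1) ^ l * (p.factorial * l.factorial) *
        (((n + (p + 2 * l + 3) : ℕ) + 1 : ℝ) ^ 2 / 8)) * (δ * (n + 1)) := by ring
    _ ≤ (∏ q ∈ range (p + 2 * l + 2), (δ + n + (q + 1 : ℕ))) * (δ + n + (0 : ℕ)) := by
      refine mul_le_mul ((le_of_le_of_eq ?_ h2.symm).trans h1) (by simpa using h0)
        (by positivity) (prod_nonneg fun _ _ => by positivity)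
      gcongr

theorem rise_ne_zero {b : ℂ} (hb : 0 < b.re) (K : ℕ) : rise b K ≠ 0 := by
  refine prod_ne_zero_iff.2 fun i _ h => ?_
  have := congrArg Complex.re h
  simp only [Complex.add_re, Complex.natCast_re, Complex.zero_re] at this
  linarith [(Nat.cast_nonneg i : (0:ℝ) ≤ i)]

theorem le_norm_rise {δ : ℝ} (hδ : 0 < δ) (hδ1 : δ ≤ 1) {b : ℂ} (hb : δ ≤ b.re) (K : ℕ) :
    δ ^ K * K.factorial ≤ ‖rise b K‖ := by
  have h1 : δ ^ K = ∏ _i ∈ range K, δ := by simp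
  rw [rise, norm_prod, ← prod_range_add_one_eq_factorial, Nat.cast_prod, h1, ← prod_mul_distrib]
  refine prod_le_prod (fun _ _ => by positivity) fun q _ => ?_
  refine le_trans ?_ (Complex.re_le_norm _)
  simp only [Complex.add_re, Complex.natCast_re]
  push_cast
  nlinarith [(Nat.cast_nonneg q : (0:ℝ) ≤ q)]

/-- The constant in the bound of the interaction terms. -/
def interactionConst (δ r M : ℝ) : ℝ := 8 / δ * r ^ 3 * M ^ 2 * Real.exp r * Real.exp (r * M)

theorem interactionConst_pos {δ r M : ℝ} (hδ : 0 < δ) (hr : 0 < r) (hM : 0 < M) :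
    0 < interactionConst δ r M := by
  unfold interactionConst
  positivity

/-- With `K = n + (p + 2l + 3)`, the quotient `rise b K / rise b n` is large enough by `le_prod_add`
to absorb the powers of `n + 1` from `norm_coeff_pow_le`; what remains is summable in `p`, `l` and
`K`. -/
theorem norm_interaction_term_le {δ r M ν : ℝ} (hδ : 0 < δ) (hδ1 : δ ≤ 1) (hr : 0 < r) (hM : 0 < M)
    (hν : 0 ≤ ν) {b : ℂ} (hb : δ ≤ b.re) {χ : ℂ⟦X⟧}
    (h : ∀ n, ‖PowerSeries.coeff n χ‖ ≤ M * ‖rise b n‖) {v : ℂ} (K p l : ℕ)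
    (hv : ‖v‖ ≤ ν * r ^ (p + l + 3)) :
    ‖v * PowerSeries.coeff K (PowerSeries.X ^ (p + 2 * l + 3) * χ ^ (l + 2))‖ ≤
      ν * (8 / δ * r ^ 3 * M ^ 2) * (r ^ p / p.factorial) * ((r * M) ^ l / l.factorial) /
        ((K : ℝ) + 1) ^ 2 * ‖rise b K‖ := by
  rw [PowerSeries.coeff_X_pow_mul']
  split_ifs with hK
  · obtain ⟨n, rfl⟩ := Nat.exists_eq_add_of_le' hK
    rw [Nat.add_sub_cancel, norm_mul]
    have h1 : ‖rise b n‖ * ∏ q ∈ range (p + 2 * l + 3), (δ + n + q) ≤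
        ‖rise b (n + (p + 2 * l + 3))‖ := by
      rw [rise_add, norm_mul, norm_prod]
      gcongr with q
      refine le_trans ?_ (Complex.re_le_norm _)
      simp [hb]
    have h2 := (mul_le_mul_of_nonneg_left (le_prod_add hδ hδ1 n p l)
      (norm_nonneg (rise b n))).trans h1
    set W := ‖rise b (n + (p + 2 * l + 3))‖
    set k := ((n + (p + 2 * l + 3) : ℕ) + 1 : ℝ)
    have hk : 0 < k := by positivity
    calc _ ≤ (ν * r ^ (p + l + 3)) * (M ^ (l + 2) * ((n : ℝ) + 1) ^ (l + 1) * ‖rise b n‖) := by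
          gcongr
          exact norm_coeff_pow_le (hδ.le.trans hb) hM.le h (l + 1) n
      _ = (ν * (8 / δ * r ^ 3 * M ^ 2) * (r ^ p / p.factorial) * ((r * M) ^ l / l.factorial) /
          k ^ 2) * (‖rise b n‖ * (δ / 8 * k ^ 2 * ((n : ℝ) + 1) ^ (l + 1) *
          (p.factorial * l.factorial))) := by
          field_simp
          ring
      _ ≤ _ := by gcongr
  · simp only [mul_zero, norm_zero]
    positivity

theorem norm_interaction_le {δ r M ν : ℝ} (hδ : 0 < δ) (hδ1 : δ ≤ 1) (hr : 0 < r) (hM : 0 < M)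
    (hν : 0 ≤ ν) {b : ℂ} (hb : δ ≤ b.re) {χ : ℂ⟦X⟧}
    (h : ∀ n, ‖PowerSeries.coeff n χ‖ ≤ M * ‖rise b n‖) {u : ℕ → ℕ → ℂ}
    (hu : ∀ p l, ‖u (p + 1) (l + 2)‖ ≤ ν * r ^ (p + l + 3)) (K : ℕ) :
    ‖interaction u χ K‖ ≤ ν * interactionConst δ r M / ((K : ℝ) + 1) ^ 2 * ‖rise b K‖ := by
  calc _ ≤ ∑ p ∈ range (K + 2), ∑ l ∈ range (K + 1),
        ν * (8 / δ * r ^ 3 * M ^ 2) * (r ^ p / p.factorial) * ((r * M) ^ l / l.factorial) /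
        ((K : ℝ) + 1) ^ 2 * ‖rise b K‖ :=
        norm_sum_le_of_le _ fun p _ => norm_sum_le_of_le _ fun l _ =>
          norm_interaction_term_le hδ hδ1 hr hM hν hb h K p l (hu p l)
    _ = ν * (8 / δ * r ^ 3 * M ^ 2) * ((∑ p ∈ range (K + 2), r ^ p / p.factorial) *
        ∑ l ∈ range (K + 1), (r * M) ^ l / l.factorial) / ((K : ℝ) + 1) ^ 2 * ‖rise b K‖ := by
        rw [sum_mul_sum]
        simp only [mul_sum, sum_mul, sum_div, mul_assoc]
    _ ≤ ν * (8 / δ * r ^ 3 * M ^ 2) * (Real.exp r * Real.exp (r * M)) / ((K : ℝ) + 1) ^ 2 *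
        ‖rise b K‖ := by
        gcongr
        · exact Real.sum_le_exp_of_nonneg hr.le _
        · exact Real.sum_le_exp_of_nonneg (by positivity) _
    _ = _ := by
        unfold interactionConst
        ring

/-- The `K`-th term of the majorant of the series for the leading coefficient. -/
def majorant (δ r D ν M : ℝ) (K : ℕ) : ℝ :=
  D * r ^ 2 * ((r / δ) ^ K / K.factorial) + ν * interactionConst δ r M * (1 / ((K : ℝ) + 1) ^ 2)

/-- The sum of the inverse squares. -/
def invSqSum : ℝ := ∑' K : ℕ, 1 / ((K : ℝ) + 1) ^ 2

theorem summable_inv_sq : Summable fun K : ℕ => 1 / ((K : ℝ) + 1) ^ 2 := by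
  have := (summable_nat_add_iff 1).2 (Real.summable_one_div_nat_pow.2 one_lt_two)
  simpa using this

theorem invSqSum_pos : 0 < invSqSum :=
  summable_inv_sq.tsum_pos (fun _ => by positivity) 0 (by norm_num)

theorem hasSum_majorant (δ r D ν M : ℝ) : HasSum (majorant δ r D ν M)
    (D * r ^ 2 * Real.exp (r / δ) + ν * interactionConst δ r M * invSqSum) := by
  refine HasSum.add (HasSum.mul_left _ ?_) (summable_inv_sq.hasSum.mul_left _)
  rw [Real.exp_eq_exp_ℝ]
  exact NormedSpace.expSeries_div_hasSum_exp (r / δ)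

/-! ### The a priori bound for the formal solution -/

/-- An a priori bound for the normalized coefficients of the formal solution. -/
def amplitude (δ r D : ℝ) : ℝ := D * r ^ 2 * Real.exp (r / δ) + 1

/-- The hypotheses under which the formal solution satisfies the bound `amplitude`. -/
structure Controlled (δ r D ν : ℝ) (b : ℂ) (f : ℕ → ℂ) (u : ℕ → ℕ → ℂ) : Prop where
  δ_pos : 0 < δ
  δ_le : δ ≤ 1
  r_pos : 0 < r
  D_nonneg : 0 ≤ D
  ν_nonneg : 0 ≤ ν
  ν_small : ν * interactionConst δ r (amplitude δ r D) * invSqSum ≤ 1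
  re_b : δ ≤ b.re
  norm_f : ∀ K, ‖f (K + 2)‖ ≤ D * r ^ (K + 2)
  norm_u : ∀ p l, ‖u (p + 1) (l + 2)‖ ≤ ν * r ^ (p + l + 3)

namespace Controlled

variable {δ r D ν : ℝ} {b : ℂ} {f : ℕ → ℂ} {u : ℕ → ℕ → ℂ}

theorem amplitude_pos (h : Controlled δ r D ν b f u) : 0 < amplitude δ r D := by
  have := h.D_nonneg
  unfold amplitude
  positivity

theorem majorant_nonneg (h : Controlled δ r D ν b f u) (K : ℕ) :
    0 ≤ majorant δ r D ν (amplitude δ r D) K := by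
  have := h.D_nonneg
  have := h.ν_nonneg
  have := h.δ_pos
  have := h.r_pos
  have := (interactionConst_pos h.δ_pos h.r_pos h.amplitude_pos).le
  unfold majorant
  positivity

theorem sum_majorant_le (h : Controlled δ r D ν b f u) (s : Finset ℕ) :
    ∑ j ∈ s, majorant δ r D ν (amplitude δ r D) j ≤ amplitude δ r D := by
  refine (sum_le_hasSum s (fun j _ => h.majorant_nonneg j) (hasSum_majorant _ _ _ _ _)).trans ?_
  -- The summand `1` in `amplitude` is the room reserved for the nonlinear part of the majorant.
  have := h.ν_small
  conv_rhs => unfold amplitude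
  linarith

theorem norm_f_le (h : Controlled δ r D ν b f u) (K : ℕ) :
    ‖f (K + 2)‖ ≤ D * r ^ 2 * ((r / δ) ^ K / K.factorial) * ‖rise b K‖ := by
  have := h.D_nonneg
  have := h.δ_pos
  have := h.r_pos
  calc _ ≤ D * r ^ (K + 2) := h.norm_f K
    _ = D * r ^ 2 * ((r / δ) ^ K / K.factorial) * (δ ^ K * K.factorial) := by
      rw [div_pow]
      field_simp
      ring
    _ ≤ _ := by
      gcongr
      exact le_norm_rise h.δ_pos h.δ_le h.re_b K

theorem norm_source_le (h : Controlled δ r D ν b f u) {χ : ℂ⟦X⟧}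
    (hχ : ∀ n, ‖PowerSeries.coeff n χ‖ ≤ amplitude δ r D * ‖rise b n‖) (K : ℕ) :
    ‖f (K + 2) + interaction u χ K‖ ≤ majorant δ r D ν (amplitude δ r D) K * ‖rise b K‖ := by
  refine (norm_add_le _ _).trans ?_
  unfold majorant
  rw [add_mul, mul_one_div]
  exact add_le_add (h.norm_f_le K)
    (norm_interaction_le h.δ_pos h.δ_le h.r_pos h.amplitude_pos h.ν_nonneg h.re_b hχ h.norm_u K)

/-- All partial sums of the majorant stay below `amplitude`, so the bound for one iterate allows the
source of the next to be estimated with the same constant. The linear term multiplies by `b + K =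
rise b (K + 1) / rise b K` and so passes on the normalized bound unchanged. -/
theorem norm_coeff_iter_le (h : Controlled δ r D ν b f u) (N K : ℕ) :
    ‖PowerSeries.coeff K (iter b f u N)‖ ≤
      (∑ j ∈ range (K + 1), majorant δ r D ν (amplitude δ r D) j) * ‖rise b K‖ := by
  induction N generalizing K with
  | zero =>
    simp only [iter, map_zero, norm_zero]
    exact mul_nonneg (sum_nonneg fun j _ => h.majorant_nonneg j) (norm_nonneg _)
  | succ N ih =>
    have hs := h.norm_source_le fun n => (ih n).trans
      (mul_le_mul_of_nonneg_right (h.sum_majorant_le _) (norm_nonneg _))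
    cases K with
    | zero => simpa [iter, step] using hs 0
    | succ K =>
      simp only [iter, step, PowerSeries.coeff_mk, PowerSeries.coeff_succ_X_mul]
      rw [sum_range_succ, add_mul, add_comm (_ * _)]
      refine (norm_sub_le _ _).trans (add_le_add (hs _) ?_)
      rw [rise_succ, norm_mul, norm_mul, mul_left_comm, ← mul_assoc, mul_comm]
      push_cast
      rw [add_sub_assoc, add_sub_cancel_right]
      gcongr
      exact (ih K).trans_eq (mul_comm _ _)

theorem norm_coeff_sol_le (h : Controlled δ r D ν b f u) (K : ℕ) :
    ‖PowerSeries.coeff K (sol b f u)‖ ≤ amplitude δ r D * ‖rise b K‖ := by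
  rw [← coeff_iter b f u (Nat.lt_succ_self K)]
  exact (h.norm_coeff_iter_le _ K).trans
    (mul_le_mul_of_nonneg_right (h.sum_majorant_le _) (norm_nonneg _))

end Controlled

/-! ### The telescoped recursion -/

/-- The `K`-th summand of the leading coefficient, without the factor `1 / Γ(b)`. -/
def summand {𝕜 : Type*} [Field 𝕜] (b : 𝕜) (f : ℕ → 𝕜) (u : ℕ → ℕ → 𝕜) (K : ℕ) : 𝕜 :=
  (-1) ^ K * (f (K + 2) + interaction u (sol b f u) K) / rise b K

/-- The contribution of the nonlinear terms to `summand`. -/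
def interactionSummand {𝕜 : Type*} [Field 𝕜] (b : 𝕜) (f : ℕ → 𝕜) (u : ℕ → ℕ → 𝕜) (K : ℕ) : 𝕜 :=
  (-1) ^ K * interaction u (sol b f u) K / rise b K

theorem map_summand {𝕜 𝕜' : Type*} [Field 𝕜] [Field 𝕜'] (σ : 𝕜 →+* 𝕜') (b : 𝕜) (f : ℕ → 𝕜)
    (u : ℕ → ℕ → 𝕜) (K : ℕ) :
    σ (summand b f u K) = summand (σ b) (fun k => σ (f k)) (fun k l => σ (u k l)) K := by
  simp [summand, map_interaction, map_sol, map_rise]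

/-- After division by `(-1) ^ K * rise b K`, the linear term of the recursion becomes the previous
normalized coefficient. -/
theorem sum_summand {𝕜 : Type*} [Field 𝕜] {b : 𝕜} (hb : ∀ K, rise b K ≠ 0) (f : ℕ → 𝕜)
    (u : ℕ → ℕ → 𝕜) (K : ℕ) : ∑ j ∈ range (K + 1), summand b f u j =
      (-1) ^ K * PowerSeries.coeff K (sol b f u) / rise b K := by
  induction K with
  | zero => simp [summand, coeff_zero_sol]
  | succ K ih =>
    have h1 := hb (K + 1)
    have h2 := hb K
    rw [sum_range_succ, ih, summand, coeff_succ_sol]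
    rw [rise_succ] at h1 ⊢
    have h3 := right_ne_zero_of_mul h1
    field_simp
    ring

namespace Controlled

variable {δ r D ν : ℝ} {b : ℂ} {f : ℕ → ℂ} {u : ℕ → ℕ → ℂ}

theorem re_b_pos (h : Controlled δ r D ν b f u) : 0 < b.re := h.δ_pos.trans_le h.re_b

theorem norm_summand_le (h : Controlled δ r D ν b f u) (K : ℕ) :
    ‖summand b f u K‖ ≤ majorant δ r D ν (amplitude δ r D) K := by
  rw [summand, norm_div, div_le_iff₀ (norm_pos_iff.2 (rise_ne_zero h.re_b_pos K))]
  simpa using h.norm_source_le h.norm_coeff_sol_le K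

theorem norm_interactionSummand_le (h : Controlled δ r D ν b f u) (K : ℕ) :
    ‖interactionSummand b f u K‖ ≤
      ν * interactionConst δ r (amplitude δ r D) * (1 / ((K : ℝ) + 1) ^ 2) := by
  rw [interactionSummand, norm_div, div_le_iff₀ (norm_pos_iff.2 (rise_ne_zero h.re_b_pos K)),
    mul_one_div]
  simpa using norm_interaction_le h.δ_pos h.δ_le h.r_pos h.amplitude_pos h.ν_nonneg h.re_b
    h.norm_coeff_sol_le h.norm_u K

theorem summable_summand (h : Controlled δ r D ν b f u) : Summable (summand b f u) :=
  Summable.of_norm_bounded (hasSum_majorant _ _ _ _ _).summable h.norm_summand_le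

end Controlled

/-! ### Cauchy estimates and series of holomorphic functions -/

section Holomorphic

variable {E : Type*} [NormedAddCommGroup E] [NormedSpace ℂ E]

theorem norm_fderiv_le_of_norm_le_on_ball {g : E → ℂ} {x : E} {R W : ℝ} (hR : 0 < R)
    (hg : DifferentiableOn ℂ g (Metric.ball x R)) (hW : ∀ y ∈ Metric.ball x R, ‖g y‖ ≤ W) :
    ‖fderiv ℂ g x‖ ≤ 2 * W / R := by
  -- The factor `2` arises because values bounded by `W` lie in the closed ball of radius `2 * W`
  -- about `g x`.
  refine Complex.norm_fderiv_le_div_of_mapsTo_ball hg (fun y hy => ?_) hR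
  rw [mem_closedBall_iff_norm]
  linarith [norm_sub_le (g y) (g x), hW y hy, hW x (Metric.mem_ball_self hR)]

/-- A series of `C¹` functions on an open subset of a complex normed space is `C¹` as soon as it is
dominated by a convergent series of constants. -/
theorem contDiffOn_one_tsum {g : ℕ → E → ℂ} {U : Set E} {w : ℕ → ℝ} (hU : IsOpen U)
    (hw : Summable w) (hg : ∀ n, ContDiffOn ℂ 1 (g n) U) (hgw : ∀ n, ∀ x ∈ U, ‖g n x‖ ≤ w n) :
    ContDiffOn ℂ 1 (fun x => ∑' n, g n x) U := by
  intro x₀ hx₀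
  refine ContDiffAt.contDiffWithinAt ?_
  obtain ⟨R, hR, hRU⟩ := Metric.isOpen_iff.1 hU x₀ hx₀
  -- Halving the radius leaves a ball of fixed size in `U` around every point considered, so the
  -- Cauchy estimate is uniform.
  have hsub : ∀ x ∈ Metric.ball x₀ (R / 2), Metric.ball x (R / 2) ⊆ U := fun x hx =>
    (Metric.ball_subset_ball' (by linarith [Metric.mem_ball.1 hx])).trans hRU
  have hmem : ∀ x ∈ Metric.ball x₀ (R / 2), x ∈ U := fun x hx =>
    hsub x hx (Metric.mem_ball_self (half_pos hR))
  have hd : ∀ n, DifferentiableOn ℂ (g n) U := fun n => (hg n).differentiableOn one_ne_zero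
  have hbound : ∀ n, ∀ x ∈ Metric.ball x₀ (R / 2), ‖fderiv ℂ (g n) x‖ ≤ 2 * w n / (R / 2) :=
    fun n x hx => norm_fderiv_le_of_norm_le_on_ball (half_pos hR) ((hd n).mono (hsub x hx))
      fun y hy => hgw n y (hsub x hx hy)
  have hsum : Summable fun n => 2 * w n / (R / 2) := (hw.mul_left 2).div_const _
  refine contDiffAt_one_iff.2 ⟨fun x => ∑' n, fderiv ℂ (g n) x, Metric.ball x₀ (R / 2),
    Metric.ball_mem_nhds _ (half_pos hR), ?_, fun x hx => ?_⟩
  · exact continuousOn_tsum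
      (fun n => ((hg n).continuousOn_fderiv_of_isOpen hU le_rfl).mono hmem) hsum hbound
  · exact hasFDerivAt_tsum_of_isPreconnected hsum Metric.isOpen_ball
      (convex_ball x₀ (R / 2)).isPreconnected
      (fun n y hy => ((hd n).differentiableAt (hU.mem_nhds (hmem y hy))).hasFDerivAt) hbound
      (Metric.mem_ball_self (half_pos hR))
      (Summable.of_norm_bounded hw fun n => hgw n x₀ hx₀) hx

end Holomorphic

/-! ### Smoothness of each summand in the parameters -/

section Smooth

variable {𝕜 E : Type*} [NontriviallyNormedField 𝕜] [NormedAddCommGroup E] [NormedSpace 𝕜 E]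
  {n : ℕ∞ω} {U : Set E} {b : E → 𝕜} {f : E → ℕ → 𝕜} {u : E → ℕ → ℕ → 𝕜} {χ : E → 𝕜⟦X⟧}

theorem contDiffOn_coeff_pow (hχ : ∀ K, ContDiffOn 𝕜 n (fun x => PowerSeries.coeff K (χ x)) U)
    (l K : ℕ) : ContDiffOn 𝕜 n (fun x => PowerSeries.coeff K (χ x ^ l)) U := by
  induction l generalizing K with
  | zero => simpa using contDiffOn_const
  | succ l ih =>
    simp only [pow_succ, PowerSeries.coeff_mul]
    exact ContDiffOn.sum fun p _ => (ih _).mul (hχ _)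

theorem contDiffOn_interaction
    (hχ : ∀ K, ContDiffOn 𝕜 n (fun x => PowerSeries.coeff K (χ x)) U)
    (hu : ∀ k l, ContDiffOn 𝕜 n (fun x => u x k l) U) (K : ℕ) :
    ContDiffOn 𝕜 n (fun x => interaction (u x) (χ x) K) U := by
  unfold interaction
  refine ContDiffOn.sum fun p _ => ContDiffOn.sum fun l _ => (hu _ _).mul ?_
  simp only [PowerSeries.coeff_X_pow_mul']
  split_ifs
  · exact contDiffOn_coeff_pow hχ _ _
  · exact contDiffOn_const

theorem contDiffOn_coeff_iter (hb : ContDiffOn 𝕜 n b U)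
    (hf : ∀ k, ContDiffOn 𝕜 n (fun x => f x k) U)
    (hu : ∀ k l, ContDiffOn 𝕜 n (fun x => u x k l) U) (N K : ℕ) :
    ContDiffOn 𝕜 n (fun x => PowerSeries.coeff K (iter (b x) (f x) (u x) N)) U := by
  induction N generalizing K with
  | zero => simpa [iter] using contDiffOn_const
  | succ N ih =>
    simp only [iter, step, PowerSeries.coeff_mk]
    refine ((hf _).add (contDiffOn_interaction ih hu K)).sub
      (((hb.add contDiffOn_const).sub contDiffOn_const).mul ?_)
    cases K with
    | zero => simpa using contDiffOn_const
    | succ K => simpa only [PowerSeries.coeff_succ_X_mul] using ih K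

theorem contDiffOn_interaction_sol (hb : ContDiffOn 𝕜 n b U)
    (hf : ∀ k, ContDiffOn 𝕜 n (fun x => f x k) U)
    (hu : ∀ k l, ContDiffOn 𝕜 n (fun x => u x k l) U) (K : ℕ) :
    ContDiffOn 𝕜 n (fun x => interaction (u x) (sol (b x) (f x) (u x)) K) U :=
  contDiffOn_interaction
    (fun K => by simpa only [sol, PowerSeries.coeff_mk] using contDiffOn_coeff_iter hb hf hu _ K)
    hu K

theorem contDiffOn_rise (hb : ContDiffOn 𝕜 n b U) (K : ℕ) :
    ContDiffOn 𝕜 n (fun x => rise (b x) K) U := by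
  unfold rise
  exact contDiffOn_prod fun i _ => hb.add contDiffOn_const

theorem contDiffOn_interactionSummand (hb : ContDiffOn 𝕜 n b U)
    (hf : ∀ k, ContDiffOn 𝕜 n (fun x => f x k) U)
    (hu : ∀ k l, ContDiffOn 𝕜 n (fun x => u x k l) U) (h0 : ∀ x ∈ U, ∀ K, rise (b x) K ≠ 0)
    (K : ℕ) : ContDiffOn 𝕜 n (fun x => interactionSummand (b x) (f x) (u x) K) U :=
  (contDiffOn_const.mul (contDiffOn_interaction_sol hb hf hu K)).div (contDiffOn_rise hb K)
    fun x hx => h0 x hx K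

theorem contDiffOn_summand (hb : ContDiffOn 𝕜 n b U)
    (hf : ∀ k, ContDiffOn 𝕜 n (fun x => f x k) U)
    (hu : ∀ k l, ContDiffOn 𝕜 n (fun x => u x k l) U) (h0 : ∀ x ∈ U, ∀ K, rise (b x) K ≠ 0)
    (K : ℕ) : ContDiffOn 𝕜 n (fun x => summand (b x) (f x) (u x) K) U :=
  (contDiffOn_const.mul ((hf _).add (contDiffOn_interaction_sol hb hf hu K))).div
    (contDiffOn_rise hb K) fun x hx => h0 x hx K

end Smooth

theorem Controlled.contDiffOn_tsum_summand {E : Type*} [NormedAddCommGroup E] [NormedSpace ℂ E]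
    {U : Set E} (hU : IsOpen U) {b : E → ℂ} {f : E → ℕ → ℂ} {u : E → ℕ → ℕ → ℂ} {δ r D ν : ℝ}
    (h : ∀ x ∈ U, Controlled δ r D ν (b x) (f x) (u x)) (hb : ContDiffOn ℂ 1 b U)
    (hf : ∀ k, ContDiffOn ℂ 1 (fun x => f x k) U)
    (hu : ∀ k l, ContDiffOn ℂ 1 (fun x => u x k l) U) :
    ContDiffOn ℂ 1 (fun x => ∑' K, summand (b x) (f x) (u x) K) U :=
  contDiffOn_one_tsum hU (hasSum_majorant _ _ _ _ _).summable
    (contDiffOn_summand hb hf hu fun x hx => rise_ne_zero (h x hx).re_b_pos)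
    fun K x hx => (h x hx).norm_summand_le K

theorem Controlled.contDiffOn_tsum_interactionSummand {E : Type*} [NormedAddCommGroup E]
    [NormedSpace ℂ E] {U : Set E} (hU : IsOpen U) {b : E → ℂ} {f : E → ℕ → ℂ}
    {u : E → ℕ → ℕ → ℂ} {δ r D ν : ℝ}
    (h : ∀ x ∈ U, Controlled δ r D ν (b x) (f x) (u x)) (hb : ContDiffOn ℂ 1 b U)
    (hf : ∀ k, ContDiffOn ℂ 1 (fun x => f x k) U)
    (hu : ∀ k l, ContDiffOn ℂ 1 (fun x => u x k l) U) :
    ContDiffOn ℂ 1 (fun x => ∑' K, interactionSummand (b x) (f x) (u x) K) U :=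
  contDiffOn_one_tsum hU (summable_inv_sq.mul_left _)
    (contDiffOn_interactionSummand hb hf hu fun x hx => rise_ne_zero (h x hx).re_b_pos)
    fun K x hx => (h x hx).norm_interactionSummand_le K

theorem Controlled.norm_tsum_interactionSummand_le {δ r D ν : ℝ} {b : ℂ} {f : ℕ → ℂ}
    {u : ℕ → ℕ → ℂ} (h : Controlled δ r D ν b f u) :
    ‖∑' K, interactionSummand b f u K‖ ≤
      ν * interactionConst δ r (amplitude δ r D) * invSqSum :=
  tsum_of_norm_bounded (summable_inv_sq.hasSum.mul_left _) h.norm_interactionSummand_le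

/-! ### The leading coefficient as a limit -/

/-- The limit of the normalized coefficients of the formal center manifold. -/
def leadingCoeff (a : ℝ) (f : ℕ → ℝ) (u : ℕ → ℕ → ℝ) : ℝ :=
  (Real.Gamma (a + 2))⁻¹ * ∑' K, summand (a + 2) f u K

theorem ofReal_summand (a : ℝ) (f : ℕ → ℝ) (u : ℕ → ℕ → ℝ) (K : ℕ) :
    ((summand (a + 2) f u K : ℝ) : ℂ) =
      summand ((a : ℂ) + 2) (fun k => (f k : ℂ)) (fun k l => (u k l : ℂ)) K := by
  simpa using map_summand Complex.ofRealHom (a + 2) f u K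

theorem ofReal_leadingCoeff (a : ℝ) (f : ℕ → ℝ) (u : ℕ → ℕ → ℝ) :
    (leadingCoeff a f u : ℂ) = (Complex.Gamma ((a : ℂ) + 2))⁻¹ *
      ∑' K, summand ((a : ℂ) + 2) (fun k => (f k : ℂ)) (fun k l => (u k l : ℂ)) K := by
  simp only [leadingCoeff, Complex.ofReal_mul, Complex.ofReal_inv, Complex.ofReal_tsum,
    ofReal_summand, ← Complex.Gamma_ofReal]
  simp

theorem Gamma_add_natCast {b : ℝ} (hb : 0 < b) (K : ℕ) :
    Real.Gamma (b + K) = rise b K * Real.Gamma b := by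
  induction K with
  | zero => simp [rise]
  | succ K ih =>
    rw [rise_succ, Nat.cast_succ, ← add_assoc, Real.Gamma_add_one (by positivity), ih]
    ring

/-- At `k = K + 2` one has `Γ(k + a) = rise b K * Γ(b)`, so the sequence is `1/Γ(b)` times the
partial sums of the convergent series. -/
theorem Controlled.tendsto_leadingCoeff {δ r D ν a : ℝ} {f : ℕ → ℝ} {u : ℕ → ℕ → ℝ}
    (h : Controlled δ r D ν ((a : ℂ) + 2) (fun k => (f k : ℂ)) (fun k l => (u k l : ℂ))) :
    Filter.Tendsto (fun k : ℕ => (-1) ^ k / Real.Gamma (k + a) *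
        PowerSeries.coeff k (PowerSeries.X ^ 2 * sol (a + 2) f u))
      Filter.atTop (nhds (leadingCoeff a f u)) := by
  have hb : 0 < a + 2 := by simpa using h.re_b_pos
  have hrise : ∀ K, rise (a + 2) K ≠ 0 := fun K =>
    (prod_pos fun i _ => by positivity : 0 < rise (a + 2) K).ne'
  have hs : Summable (summand (a + 2) f u) := by
    rw [← Complex.summable_ofReal]
    simpa only [ofReal_summand] using h.summable_summand
  rw [← Filter.tendsto_add_atTop_iff_nat 2]
  have h1 := (hs.hasSum.tendsto_sum_nat.comp (Filter.tendsto_add_atTop_nat 1)).const_mul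
    (Real.Gamma (a + 2))⁻¹
  refine h1.congr fun K => ?_
  have hG := (Real.Gamma_pos_of_pos hb).ne'
  have h2 : ((K + 2 : ℕ) : ℝ) + a = a + 2 + K := by
    push_cast
    ring
  have hK := hrise K
  rw [Function.comp_apply, sum_summand hrise, PowerSeries.coeff_X_pow_mul, h2,
    Gamma_add_natCast hb]
  field_simp
  ring

/-! ### The threshold for the coupling -/

section Constants

/-- The constant controlling the nonlinear terms, for sources bounded by `B + 1`. -/
def couplingConst (δ r B : ℝ) : ℝ := interactionConst δ r (amplitude δ r (B + 1)) * invSqSum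

variable {δ r B : ℝ}

theorem couplingConst_pos (hδ : 0 < δ) (hr : 0 < r) (hB : 0 ≤ B) : 0 < couplingConst δ r B := by
  refine mul_pos (interactionConst_pos hδ hr ?_) invSqSum_pos
  unfold amplitude
  positivity

/-- The bound `μ₀` for the size of the nonlinear terms. -/
def couplingBound (δ r B : ℝ) : ℝ := min 1 (r ^ 2) / (2 * couplingConst δ r B)

theorem couplingBound_pos (hδ : 0 < δ) (hr : 0 < r) (hB : 0 ≤ B) : 0 < couplingBound δ r B := by
  have := couplingConst_pos hδ hr hB
  unfold couplingBound
  positivity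

/-- This yields the smallness condition of `Controlled`. The factor `2` leaves room for a complex
neighbourhood in which the rescaled `h` may have norm up to `2`. -/
theorem couplingBound_mul_le_one (hδ : 0 < δ) (hr : 0 < r) (hB : 0 ≤ B) :
    2 * couplingBound δ r B * couplingConst δ r B ≤ 1 := by
  have := couplingConst_pos hδ hr hB
  have h : 2 * couplingBound δ r B * couplingConst δ r B = min 1 (r ^ 2) := by
    unfold couplingBound
    field_simp
  exact h.trans_le (min_le_left _ _)

/-- This makes the Cauchy bound `2 * μ * C / r ^ 2` for the derivative of the nonlinear part less
than `1` when `μ` is below the threshold, so that the derivative in `f_2` cannot vanish. -/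
theorem couplingBound_mul_le_sq (hδ : 0 < δ) (hr : 0 < r) (hB : 0 ≤ B) :
    2 * couplingBound δ r B * couplingConst δ r B ≤ r ^ 2 := by
  have := couplingConst_pos hδ hr hB
  have h : 2 * couplingBound δ r B * couplingConst δ r B = min 1 (r ^ 2) := by
    unfold couplingBound
    field_simp
  exact h.trans_le (min_le_right _ _)

theorem controlled_of_le (hδ : 0 < δ) (hδ1 : δ ≤ 1) (hr : 0 < r) (hB : 0 ≤ B) {ν : ℝ}
    (hν : 0 ≤ ν) (hν' : ν ≤ 2 * couplingBound δ r B) {b : ℂ} (hb : δ ≤ b.re) {f : ℕ → ℂ}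
    {u : ℕ → ℕ → ℂ} (hf : ∀ K, ‖f (K + 2)‖ ≤ (B + 1) * r ^ (K + 2))
    (hu : ∀ p l, ‖u (p + 1) (l + 2)‖ ≤ ν * r ^ (p + l + 3)) :
    Controlled δ r (B + 1) ν b f u where
  δ_pos := hδ
  δ_le := hδ1
  r_pos := hr
  D_nonneg := by positivity
  ν_nonneg := hν
  ν_small := by
    rw [mul_assoc]
    exact (mul_le_mul_of_nonneg_right hν' (couplingConst_pos hδ hr hB).le).trans
      (couplingBound_mul_le_one hδ hr hB)
  re_b := hb
  norm_f := hf
  norm_u := hu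

end Constants

/-! ### Joint dependence on all parameters -/

section Joint

/-- The complexification of a bounded family of real numbers. -/
def complexify (ι : Type*) : lp (fun _ : ι => ℝ) ∞ →L[ℝ] lp (fun _ : ι => ℂ) ∞ :=
  LinearMap.mkContinuous
    { toFun := fun x => ⟨fun i => (x i : ℂ), memℓp_infty (by simpa using (lp.memℓp x).bddAbove)⟩
      map_add' := fun x y => by
        ext i
        exact Complex.ofReal_add _ _
      map_smul' := fun c x => by
        ext i
        simp } 1 fun x => by
    rw [one_mul]
    refine lp.norm_le_of_forall_le (norm_nonneg _) fun i => ?_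
    simpa using lp.norm_apply_le_norm ENNReal.top_ne_zero x i

@[simp]
theorem complexify_apply {ι : Type*} (x : lp (fun _ : ι => ℝ) ∞) (i : ι) :
    complexify ι x i = (x i : ℂ) := rfl

theorem norm_complexify_le {ι : Type*} (x : lp (fun _ : ι => ℝ) ∞) : ‖complexify ι x‖ ≤ ‖x‖ := by
  refine lp.norm_le_of_forall_le (norm_nonneg _) fun i => ?_
  simpa using lp.norm_apply_le_norm ENNReal.top_ne_zero x i

/-- The complex counterpart of `Parameters`. -/
abbrev ComplexParameters : Type :=
  ℂ × ℂ × lp (fun _ : ℕ => ℂ) ∞ × lp (fun _ : ℕ × ℕ => ℂ) ∞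

/-- The inclusion of the real parameters into the complex ones. -/
def Parameters.toComplex : Parameters →L[ℝ] ComplexParameters :=
  Complex.ofRealCLM.prodMap (Complex.ofRealCLM.prodMap ((complexify ℕ).prodMap (complexify (ℕ × ℕ))))

/-- The leading coefficient as a function of complex parameters. -/
def complexLeadingCoeff (r : ℝ) (x : ComplexParameters) : ℂ :=
  (Complex.Gamma (x.1 + 2))⁻¹ * ∑' K, summand (x.1 + 2) (fun k => x.2.2.1 k * (r : ℂ) ^ k)
    (fun k l => x.2.1 * (x.2.2.2 (k, l) * (r : ℂ) ^ (k + l))) K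

theorem complexLeadingCoeff_toComplex (r : ℝ) (p : Parameters) :
    complexLeadingCoeff r p.toComplex =
      (leadingCoeff p.1 (fun k => p.2.2.1 k * r ^ k)
        (fun k l => p.2.1 * (p.2.2.2 (k, l) * r ^ (k + l))) : ℂ) := by
  rw [ofReal_leadingCoeff]
  simp [complexLeadingCoeff, Parameters.toComplex]

variable {δ r B : ℝ}

/-- The domain of holomorphy of `complexLeadingCoeff`. -/
def complexDomain (δ r B : ℝ) : Set ComplexParameters :=
  {x | δ < x.1.re + 2 ∧ ‖x.2.1‖ < couplingBound δ r B ∧ ‖x.2.2.1‖ < B + 1 ∧ ‖x.2.2.2‖ < 2}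

theorem isOpen_complexDomain : IsOpen (complexDomain δ r B) := by
  have h1 : Continuous fun x : ComplexParameters => x.1.re + 2 := by fun_prop
  have h2 : Continuous fun x : ComplexParameters => ‖x.2.1‖ := by fun_prop
  have h3 : Continuous fun x : ComplexParameters => ‖x.2.2.1‖ := by fun_prop
  have h4 : Continuous fun x : ComplexParameters => ‖x.2.2.2‖ := by fun_prop
  exact (isOpen_lt continuous_const h1).inter ((isOpen_lt h2 continuous_const).inter
    ((isOpen_lt h3 continuous_const).inter (isOpen_lt h4 continuous_const)))

theorem controlled_of_mem_complexDomain (hδ : 0 < δ) (hδ1 : δ ≤ 1) (hr : 0 < r) (hB : 0 ≤ B)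
    {x : ComplexParameters} (hx : x ∈ complexDomain δ r B) :
    Controlled δ r (B + 1) (2 * couplingBound δ r B) (x.1 + 2)
      (fun k => x.2.2.1 k * (r : ℂ) ^ k)
      (fun k l => x.2.1 * (x.2.2.2 (k, l) * (r : ℂ) ^ (k + l))) := by
  obtain ⟨h1, h2, h3, h4⟩ := hx
  have hμ := couplingBound_pos hδ hr hB
  refine controlled_of_le hδ hδ1 hr hB (by positivity) le_rfl (by simpa using h1.le)
    (fun K => ?_) fun p l => ?_
  · rw [norm_mul, norm_pow, Complex.norm_real, Real.norm_of_nonneg hr.le]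
    gcongr
    exact (lp.norm_apply_le_norm ENNReal.top_ne_zero _ _).trans h3.le
  · rw [norm_mul, norm_mul, norm_pow, Complex.norm_real, Real.norm_of_nonneg hr.le,
      show p + 1 + (l + 2) = p + l + 3 by ring, ← mul_assoc, mul_comm 2]
    gcongr
    exact (lp.norm_apply_le_norm ENNReal.top_ne_zero _ _).trans h4.le

theorem contDiff_lp_apply {ι : Type*} (i : ι) {n : ℕ∞ω} :
    ContDiff ℂ n (fun x : lp (fun _ : ι => ℂ) ∞ => x i) :=
  (lp.evalCLM ℂ (fun _ : ι => ℂ) ∞ i).contDiff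

theorem contDiffOn_complexLeadingCoeff (hδ : 0 < δ) (hδ1 : δ ≤ 1) (hr : 0 < r) (hB : 0 ≤ B) :
    ContDiffOn ℂ 1 (complexLeadingCoeff r) (complexDomain δ r B) := by
  have hb : ContDiff ℂ 1 (fun x : ComplexParameters => x.1 + 2) := contDiff_fst.add contDiff_const
  refine (Complex.differentiable_one_div_Gamma.contDiff.comp hb).contDiffOn.mul
    (Controlled.contDiffOn_tsum_summand isOpen_complexDomain
      (fun x hx => controlled_of_mem_complexDomain hδ hδ1 hr hB hx) hb.contDiffOn
      (fun k => ContDiff.contDiffOn ?_) fun k l => ContDiff.contDiffOn ?_)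
  · exact ((contDiff_lp_apply k).comp (contDiff_fst.comp (contDiff_snd.comp contDiff_snd))).mul
      contDiff_const
  · exact (contDiff_fst.comp contDiff_snd).mul
      (((contDiff_lp_apply (k, l)).comp (contDiff_snd.comp (contDiff_snd.comp contDiff_snd))).mul
      contDiff_const)

/-- The real parameter set embeds into the open complex domain because the bounds there are wider:
`δ < α + 2`, `B < B + 1` and `1 < 2`. The function is then the real part of a holomorphic one along
a real linear map. -/
theorem contDiffOn_leadingCoeff {α β : ℝ} (hδ : 0 < δ) (hδ1 : δ ≤ 1) (hα : δ < α + 2)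
    (hr : 0 < r) (hB : 0 ≤ B) :
    ContDiffOn ℝ 1 (fun p : Parameters => leadingCoeff p.1 (fun k => p.2.2.1 k * r ^ k)
        (fun k l => p.2.1 * (p.2.2.2 (k, l) * r ^ (k + l))))
      (Set.Icc α β ×ˢ Set.Ico 0 (couplingBound δ r B) ×ˢ Metric.closedBall 0 B ×ˢ
        Metric.closedBall 0 1) := by
  have h1 : ContDiffOn ℝ 1 (complexLeadingCoeff r) (complexDomain δ r B) :=
    (contDiffOn_complexLeadingCoeff hδ hδ1 hr hB).restrict_scalars ℝ
  have h2 := Complex.reCLM.contDiff.comp_contDiffOn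
    (h1.comp Parameters.toComplex.contDiff.contDiffOn (s := Set.Icc α β ×ˢ
      Set.Ico 0 (couplingBound δ r B) ×ˢ Metric.closedBall 0 B ×ˢ Metric.closedBall 0 1) ?_)
  · refine h2.congr fun p _ => ?_
    simp [complexLeadingCoeff_toComplex]
  · rintro ⟨a, μ, f, h⟩ ⟨ha, hμ, hf, hh⟩
    refine ⟨?_, ?_, ?_, ?_⟩
    · have h3 : α ≤ a := ha.1
      change δ < a + 2
      linarith
    · simpa [Parameters.toComplex, abs_of_nonneg hμ.1] using hμ.2
    · have h3 : ‖f‖ ≤ B := by simpa using hf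
      exact (norm_complexify_le f).trans_lt (by linarith)
    · have h3 : ‖h‖ ≤ 1 := by simpa using hh
      exact (norm_complexify_le h).trans_lt (by linarith)

end Joint

/-! ### Dependence on the coefficient of `x ^ 2` -/

section QuadraticCoefficient

variable {δ r B ν a : ℝ} {f : ℕ → ℝ} {u : ℕ → ℕ → ℝ}

/-- The contribution of the nonlinear terms to the leading coefficient, as a function of the
coefficient of `x ^ 2`. -/
def nonlinearPart (a : ℝ) (f : ℕ → ℝ) (u : ℕ → ℕ → ℝ) (z : ℂ) : ℂ :=
  ∑' K, interactionSummand ((a : ℂ) + 2) (Function.update (fun k => (f k : ℂ)) 2 z)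
    (fun k l => (u k l : ℂ)) K

theorem contDiff_update {n : ℕ∞ω} (g : ℕ → ℂ) (k : ℕ) :
    ContDiff ℂ n (fun z => Function.update g 2 z k) := by
  rcases eq_or_ne k 2 with rfl | hk
  · simpa using contDiff_fun_id
  · simpa [hk] using contDiff_const

theorem contDiffOn_nonlinearPart
    (h : ∀ z ∈ Metric.ball (0 : ℂ) ((B + 1) * r ^ 2), Controlled δ r (B + 1) ν ((a : ℂ) + 2)
      (Function.update (fun k => (f k : ℂ)) 2 z) (fun k l => (u k l : ℂ))) :
    ContDiffOn ℂ 1 (nonlinearPart a f u) (Metric.ball 0 ((B + 1) * r ^ 2)) :=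
  Controlled.contDiffOn_tsum_interactionSummand Metric.isOpen_ball h contDiffOn_const
    (fun k => (contDiff_update _ k).contDiffOn) fun _ _ => contDiffOn_const

/-- The nonlinear part is bounded by `ν * couplingConst` on the larger disc, which contains the disc
of radius `r ^ 2` about `z`; the Cauchy estimate applies there. This is why sources are allowed the
bound `B + 1` instead of `B`. -/
theorem norm_deriv_nonlinearPart_le (hr : 0 < r)
    (h : ∀ z ∈ Metric.ball (0 : ℂ) ((B + 1) * r ^ 2), Controlled δ r (B + 1) ν ((a : ℂ) + 2)
      (Function.update (fun k => (f k : ℂ)) 2 z) (fun k l => (u k l : ℂ)))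
    {z : ℂ} (hz : ‖z‖ ≤ B * r ^ 2) :
    ‖deriv (nonlinearPart a f u) z‖ ≤ 2 * (ν * couplingConst δ r B) / r ^ 2 := by
  have hsub : Metric.ball z (r ^ 2) ⊆ Metric.ball 0 ((B + 1) * r ^ 2) :=
    Metric.ball_subset_ball' (by rw [dist_zero_right]; linarith)
  rw [← norm_deriv_eq_norm_fderiv.symm]
  refine norm_fderiv_le_of_norm_le_on_ball (by positivity)
    (((contDiffOn_nonlinearPart h).differentiableOn one_ne_zero).mono hsub) fun y hy => ?_
  rw [couplingConst, ← mul_assoc]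
  exact (h y (hsub hy)).norm_tsum_interactionSummand_le

/-- Without the interaction, `z` enters only through the term `K = 0`, where the rising factorial is
`1`. -/
theorem tsum_summand_update {z : ℂ}
    (h : Controlled δ r (B + 1) ν ((a : ℂ) + 2)
      (Function.update (fun k => (f k : ℂ)) 2 z) (fun k l => (u k l : ℂ))) :
    ∑' K, summand ((a : ℂ) + 2) (Function.update (fun k => (f k : ℂ)) 2 z)
        (fun k l => (u k l : ℂ)) K =
      z + (∑' K, (-1) ^ (K + 1) * (f (K + 3) : ℂ) / rise ((a : ℂ) + 2) (K + 1)) +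
        nonlinearPart a f u z := by
  have h1 : Summable (interactionSummand ((a : ℂ) + 2)
      (Function.update (fun k => (f k : ℂ)) 2 z) (fun k l => (u k l : ℂ))) :=
    Summable.of_norm_bounded (summable_inv_sq.mul_left _) h.norm_interactionSummand_le
  have h2 := h.summable_summand.sub h1
  have h3 : ∀ K, summand ((a : ℂ) + 2) (Function.update (fun k => (f k : ℂ)) 2 z)
        (fun k l => (u k l : ℂ)) K - interactionSummand ((a : ℂ) + 2)
        (Function.update (fun k => (f k : ℂ)) 2 z) (fun k l => (u k l : ℂ)) K =
      (-1) ^ K * Function.update (fun k => (f k : ℂ)) 2 z (K + 2) / rise ((a : ℂ) + 2) K := by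
    intro K
    rw [summand, interactionSummand]
    ring
  have h4 := h.summable_summand.tsum_sub h1
  simp only [h3] at h2 h4
  rw [h2.tsum_eq_zero_add] at h4
  rw [nonlinearPart, ← sub_eq_iff_eq_add, ← h4]
  simp [rise]

theorem leadingCoeff_update {t : ℝ}
    (h : Controlled δ r (B + 1) ν ((a : ℂ) + 2)
      (Function.update (fun k => (f k : ℂ)) 2 (t : ℂ)) (fun k l => (u k l : ℂ))) :
    leadingCoeff a (Function.update f 2 t) u = (Real.Gamma (a + 2))⁻¹ *
      (t + (∑' K, (-1) ^ (K + 1) * (f (K + 3) : ℂ) / rise ((a : ℂ) + 2) (K + 1)).re +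
        (nonlinearPart a f u t).re) := by
  have h1 : (fun k => ((Function.update f 2 t k : ℝ) : ℂ)) =
      Function.update (fun k => (f k : ℂ)) 2 (t : ℂ) := by
    ext k
    rcases eq_or_ne k 2 with rfl | hk
    · simp
    · simp [hk]
  have h2 := tsum_summand_update h
  simp only [← h1, ← ofReal_summand, ← Complex.ofReal_tsum] at h2
  rw [leadingCoeff]
  congr 1
  simpa using congrArg Complex.re h2

theorem contDiffOn_leadingCoeff_update {s : Set ℝ} (hs : ∀ t ∈ s, |t| ≤ B * r ^ 2) (hr : 0 < r)
    (h : ∀ z ∈ Metric.ball (0 : ℂ) ((B + 1) * r ^ 2), Controlled δ r (B + 1) ν ((a : ℂ) + 2)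
      (Function.update (fun k => (f k : ℂ)) 2 z) (fun k l => (u k l : ℂ))) :
    ContDiffOn ℝ 1 (fun t => leadingCoeff a (Function.update f 2 t) u) s := by
  have hmaps : ∀ t ∈ s, (t : ℂ) ∈ Metric.ball (0 : ℂ) ((B + 1) * r ^ 2) := fun t ht => by
    have := hs t ht
    have : 0 < r ^ 2 := by positivity
    rw [mem_ball_zero_iff, Complex.norm_real, Real.norm_eq_abs]
    linarith
  have h1 : ContDiffOn ℝ 1 (nonlinearPart a f u) (Metric.ball 0 ((B + 1) * r ^ 2)) :=
    (contDiffOn_nonlinearPart h).restrict_scalars ℝ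
  have h2 : ContDiffOn ℝ 1 (fun t : ℝ => (nonlinearPart a f u t).re) s :=
    Complex.reCLM.contDiff.comp_contDiffOn (h1.comp Complex.ofRealCLM.contDiff.contDiffOn hmaps)
  exact (contDiffOn_const.mul ((contDiffOn_id.add contDiffOn_const).add h2)).congr
    fun t ht => leadingCoeff_update (h t (hmaps t ht))

theorem derivWithin_leadingCoeff_update {s : Set ℝ} (hs : ∀ t ∈ s, |t| ≤ B * r ^ 2) (hr : 0 < r)
    (h : ∀ z ∈ Metric.ball (0 : ℂ) ((B + 1) * r ^ 2), Controlled δ r (B + 1) ν ((a : ℂ) + 2)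
      (Function.update (fun k => (f k : ℂ)) 2 z) (fun k l => (u k l : ℂ)))
    (hu : UniqueDiffOn ℝ s) {t : ℝ} (ht : t ∈ s) :
    derivWithin (fun t => leadingCoeff a (Function.update f 2 t) u) s t =
      (Real.Gamma (a + 2))⁻¹ * (1 + (deriv (nonlinearPart a f u) t).re) := by
  have hmaps : ∀ t ∈ s, (t : ℂ) ∈ Metric.ball (0 : ℂ) ((B + 1) * r ^ 2) := fun t ht => by
    have := hs t ht
    have : 0 < r ^ 2 := by positivity
    rw [mem_ball_zero_iff, Complex.norm_real, Real.norm_eq_abs]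
    linarith
  have h1 : HasDerivAt (nonlinearPart a f u) (deriv (nonlinearPart a f u) t) (t : ℂ) :=
    (((contDiffOn_nonlinearPart h).differentiableOn one_ne_zero).differentiableAt
      (Metric.isOpen_ball.mem_nhds (hmaps t ht))).hasDerivAt
  have h2 := (((hasDerivAt_id t).add_const
    (∑' K, (-1) ^ (K + 1) * (f (K + 3) : ℂ) / rise ((a : ℂ) + 2) (K + 1)).re).add
      h1.real_of_complex).const_mul (Real.Gamma (a + 2))⁻¹
  exact (h2.hasDerivWithinAt.congr (fun y hy => leadingCoeff_update (h y (hmaps y hy)))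
    (leadingCoeff_update (h t (hmaps t ht)))).derivWithin (hu t ht)

end QuadraticCoefficient

/-! ### Calculus of Taylor expansions at the origin -/

section Taylor

open Asymptotics Filter Topology

/-- `φ` is the Taylor expansion of `g` at `0`, up to terms of order `n`. -/
def HasTaylor (n : ℕ) (g : ℝ → ℝ) (φ : ℝ⟦X⟧) : Prop :=
  ∃ P : Polynomial ℝ, PowerSeries.X ^ n ∣ φ - (P : ℝ⟦X⟧) ∧
    (fun x => g x - P.eval x) =O[𝓝 0] fun x => x ^ n

theorem isBigO_one_eval (P : Polynomial ℝ) : (fun x => P.eval x) =O[𝓝 0] fun _ => (1 : ℝ) :=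
  P.continuous.continuousAt.norm.isBoundedUnder_le.isBigO_one ℝ

theorem isBigO_pow_one (n : ℕ) : (fun x : ℝ => x ^ n) =O[𝓝 0] fun _ => (1 : ℝ) :=
  (continuous_pow n).continuousAt.norm.isBoundedUnder_le.isBigO_one ℝ

namespace HasTaylor

variable {n : ℕ} {g h : ℝ → ℝ} {φ ψ : ℝ⟦X⟧}

theorem of_polynomial (n : ℕ) (P : Polynomial ℝ) : HasTaylor n (fun x => P.eval x) P :=
  ⟨P, by simp, by simpa using isBigO_zero _ _⟩

theorem congr (hg : HasTaylor n g φ) (hgh : g =ᶠ[𝓝 0] h) : HasTaylor n h φ := by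
  obtain ⟨P, hP, hO⟩ := hg
  refine ⟨P, hP, hO.congr' ?_ EventuallyEq.rfl⟩
  filter_upwards [hgh] with x hx
  rw [hx]

theorem add (hg : HasTaylor n g φ) (hh : HasTaylor n h ψ) :
    HasTaylor n (fun x => g x + h x) (φ + ψ) := by
  obtain ⟨P, hP, hO⟩ := hg
  obtain ⟨Q, hQ, hO'⟩ := hh
  refine ⟨P + Q, ?_, ?_⟩
  · rw [Polynomial.coe_add, add_sub_add_comm]
    exact dvd_add hP hQ
  · simpa only [Polynomial.eval_add, add_sub_add_comm] using hO.add hO'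

theorem isBigO_one (hg : HasTaylor n g φ) : g =O[𝓝 0] fun _ => (1 : ℝ) := by
  obtain ⟨P, -, hO⟩ := hg
  simpa using (hO.trans (isBigO_pow_one n)).add (isBigO_one_eval P)

theorem mul (hg : HasTaylor n g φ) (hh : HasTaylor n h ψ) :
    HasTaylor n (fun x => g x * h x) (φ * ψ) := by
  have hb := hh.isBigO_one
  obtain ⟨P, hP, hO⟩ := hg
  obtain ⟨Q, hQ, hO'⟩ := hh
  refine ⟨P * Q, ?_, ?_⟩
  · rw [Polynomial.coe_mul, show φ * ψ - (P : ℝ⟦X⟧) * Q = (φ - P) * ψ + P * (ψ - Q) by ring]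
    exact dvd_add (hP.mul_right _) (hQ.mul_left _)
  · have h1 := hO.mul hb
    have h2 := (isBigO_one_eval P).mul hO'
    simp only [mul_one, one_mul] at h1 h2
    refine (h1.add h2).congr_left fun x => ?_
    rw [Polynomial.eval_mul]
    ring

theorem const (n : ℕ) (c : ℝ) : HasTaylor n (fun _ => c) (PowerSeries.C c) := by
  simpa using of_polynomial n (Polynomial.C c)

theorem id (n : ℕ) : HasTaylor n (fun x => x) PowerSeries.X := by
  simpa using of_polynomial n Polynomial.X

theorem pow (hg : HasTaylor n g φ) (k : ℕ) : HasTaylor n (fun x => g x ^ k) (φ ^ k) := by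
  induction k with
  | zero => simpa using const n 1
  | succ k ih => simpa only [pow_succ] using ih.mul hg

theorem sum {ι : Type*} (s : Finset ι) {g : ι → ℝ → ℝ} {φ : ι → ℝ⟦X⟧}
    (hg : ∀ i ∈ s, HasTaylor n (g i) (φ i)) :
    HasTaylor n (fun x => ∑ i ∈ s, g i x) (∑ i ∈ s, φ i) := by
  classical
  induction s using Finset.induction_on with
  | empty => simpa using const n 0
  | insert i s hi ih =>
    simp only [sum_insert hi]
    exact (hg i (mem_insert_self i s)).add (ih fun j hj => hg j (mem_insert_of_mem hj))

theorem add_isBigO (hg : HasTaylor n g φ) (hh : (fun x => h x - g x) =O[𝓝 0] fun x => x ^ n) :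
    HasTaylor n h φ := by
  obtain ⟨P, hP, hO⟩ := hg
  exact ⟨P, hP, by simpa using hh.add hO⟩

theorem congr_series (hg : HasTaylor n g φ) (h : PowerSeries.X ^ n ∣ ψ - φ) :
    HasTaylor n g ψ := by
  obtain ⟨P, hP, hO⟩ := hg
  exact ⟨P, by simpa using dvd_add h hP, hO⟩

end HasTaylor

/-- Letting `x → 0` shows that the constant term vanishes; one factor `X` is then divided out. The
punctured neighbourhood makes the cancellation of `x` legitimate. -/
theorem X_pow_dvd_of_isBigO {P : Polynomial ℝ} {n : ℕ}
    (h : (fun x => P.eval x) =O[𝓝[≠] 0] fun x => x ^ n) : Polynomial.X ^ n ∣ P := by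
  induction n generalizing P with
  | zero => simp
  | succ n ih =>
    have h0 : Tendsto (fun x : ℝ => x ^ (n + 1)) (𝓝[≠] 0) (𝓝 0) := by
      have := (continuous_pow (n + 1)).tendsto (0 : ℝ)
      rw [zero_pow n.succ_ne_zero] at this
      exact this.mono_left nhdsWithin_le_nhds
    have h1 : P.eval 0 = 0 := tendsto_nhds_unique
      ((P.continuous.tendsto 0).mono_left nhdsWithin_le_nhds) (h.trans_tendsto h0)
    obtain ⟨Q, rfl⟩ := Polynomial.X_dvd_iff.2 ((Polynomial.coeff_zero_eq_eval_zero P).trans h1)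
    rw [pow_succ']
    refine mul_dvd_mul_left _ (ih ?_)
    obtain ⟨c, hc⟩ := h.bound
    refine IsBigO.of_bound c ?_
    filter_upwards [hc, self_mem_nhdsWithin] with x hx hx0
    rw [Polynomial.eval_mul, Polynomial.eval_X, pow_succ', norm_mul, norm_mul, mul_left_comm] at hx
    exact le_of_mul_le_mul_left hx (norm_pos_iff.2 hx0)

theorem HasTaylor.unique {g : ℝ → ℝ} {φ ψ : ℝ⟦X⟧} (hφ : ∀ n, HasTaylor n g φ)
    (hψ : ∀ n, HasTaylor n g ψ) : φ = ψ := by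
  have key : ∀ n, PowerSeries.X ^ n ∣ φ - ψ := by
    intro n
    obtain ⟨P, hP, hO⟩ := hφ n
    obtain ⟨Q, hQ, hO'⟩ := hψ n
    have h1 : Polynomial.X ^ n ∣ P - Q := by
      refine X_pow_dvd_of_isBigO (((hO'.sub hO).congr_left fun x => ?_).mono nhdsWithin_le_nhds)
      rw [Polynomial.eval_sub]
      ring
    obtain ⟨T, hT⟩ := h1
    have h2 : (PowerSeries.X : ℝ⟦X⟧) ^ n ∣ (P : ℝ⟦X⟧) - (Q : ℝ⟦X⟧) := by
      rw [← Polynomial.coe_sub, hT]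
      exact ⟨T, by simp⟩
    have h3 := dvd_add (dvd_sub hP hQ) h2
    rwa [show φ - (P : ℝ⟦X⟧) - (ψ - (Q : ℝ⟦X⟧)) + ((P : ℝ⟦X⟧) - (Q : ℝ⟦X⟧)) = φ - ψ by ring] at h3
  ext m
  exact coeff_eq_of_X_pow_dvd_sub (key (m + 1)) (Nat.lt_succ_self m)

/-- The formal Taylor series of `g` at `0`. -/
def taylorSeries (g : ℝ → ℝ) : ℝ⟦X⟧ :=
  PowerSeries.mk fun k => iteratedDeriv k g 0 / k.factorial

theorem hasTaylor_taylorSeries {g : ℝ → ℝ} (hg : ContDiffAt ℝ ∞ g 0) (n : ℕ) :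
    HasTaylor n g (taylorSeries g) := by
  obtain ⟨v, hv, hgv⟩ := (hg.of_le (m := n) (by exact_mod_cast le_top)).contDiffOn le_rfl
    (by simp)
  obtain ⟨ε, hε, hεv⟩ := Metric.mem_nhds_iff.1 hv
  have h0 : (0 : ℝ) ∈ Metric.ball (0 : ℝ) ε := Metric.mem_ball_self hε
  have h1 := taylor_isLittleO (convex_ball 0 ε) h0 ((hgv.mono (by simpa using hεv)))
  rw [Metric.isOpen_ball.nhdsWithin_eq h0] at h1
  refine ⟨PowerSeries.trunc (n + 1) (taylorSeries g), ?_, ?_⟩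
  · refine PowerSeries.X_pow_dvd_iff.2 fun m hm => ?_
    rw [map_sub, Polynomial.coeff_coe, PowerSeries.coeff_trunc, if_pos (by omega), sub_self]
  · refine h1.isBigO.congr (fun x => ?_) fun x => by rw [sub_zero]
    congr 1
    rw [taylor_within_apply, PowerSeries.trunc_apply, Polynomial.eval_finsetSum, ← range_eq_Ico]
    refine sum_congr rfl fun k _ => ?_
    rw [Polynomial.eval_monomial, taylorSeries, PowerSeries.coeff_mk,
      iteratedDerivWithin_of_isOpen Metric.isOpen_ball h0, smul_eq_mul]
    ring

theorem taylorSeries_deriv (g : ℝ → ℝ) :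
    taylorSeries (deriv g) = PowerSeries.derivative ℝ (taylorSeries g) := by
  ext k
  rw [PowerSeries.coeff_derivative, taylorSeries, taylorSeries, PowerSeries.coeff_mk,
    PowerSeries.coeff_mk, iteratedDeriv_succ', Nat.factorial_succ]
  push_cast
  field_simp

end Taylor

/-! ### From center manifolds to formal solutions -/

section CenterManifold

open Asymptotics Filter Topology

/-- The constant `C` serves only for summability; the tail is governed by `c`, which in the
applications contains the small factor `|x| ^ n`. -/
theorem abs_tsum_sub_sum_le {ι : Type*} {T w : ι → ℝ} {C c : ℝ} (hw : Summable w)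
    (hT : ∀ i, |T i| ≤ C * w i) (s : Finset ι) (hs : ∀ i ∉ s, |T i| ≤ c * w i) (hc : 0 ≤ c)
    (hw0 : ∀ i, 0 ≤ w i) : |∑' i, T i - ∑ i ∈ s, T i| ≤ c * ∑' i, w i := by
  classical
  have hTs : Summable T := Summable.of_norm_bounded (hw.mul_left C) hT
  have h1 : ∑' i, T i - ∑ i ∈ s, T i = ∑' i : ↑(s : Set ι)ᶜ, T i := by
    rw [← hTs.sum_add_tsum_compl (s := s)]
    ring
  rw [h1, ← tsum_mul_left]
  have hsub : Summable fun i : ↑(s : Set ι)ᶜ => c * w i := (hw.mul_left c).subtype _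
  have h2 : |∑' i : ↑(s : Set ι)ᶜ, T i| ≤ ∑' i : ↑(s : Set ι)ᶜ, c * w i :=
    tsum_of_norm_bounded (f := fun i : ↑(s : Set ι)ᶜ => T i) hsub.hasSum fun i => hs i i.2
  exact h2.trans ((hw.mul_left c).tsum_subtype_le _ _ fun i => mul_nonneg hc (hw0 i))

/-- Of the `N` factors, `n` are kept to provide the order of vanishing and the others are replaced
by `1 / 2` to provide summability. -/
theorem pow_le_two_mul_pow_mul {t : ℝ} (ht : 0 ≤ t) (ht' : t ≤ 1 / 2) {n N : ℕ} (h : n ≤ N) :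
    t ^ N ≤ (2 * t) ^ n * (1 / 2) ^ N := by
  obtain ⟨k, rfl⟩ := Nat.exists_eq_add_of_le h
  calc t ^ (n + k) = t ^ n * t ^ k := pow_add _ _ _
    _ ≤ t ^ n * (1 / 2) ^ k := by gcongr
    _ = (2 * t) ^ n * (1 / 2) ^ (n + k) := by
      have h2 : (2 : ℝ) ^ n * (1 / 2) ^ n = 1 := by
        rw [← mul_pow]
        norm_num
      rw [mul_pow, pow_add, mul_mul_mul_comm, h2, one_mul]

variable {r D ν : ℝ} {f : ℕ → ℝ} {u : ℕ → ℕ → ℝ}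

theorem eventually_abs_mul_le (r : ℝ) : ∀ᶠ x in 𝓝 (0 : ℝ), |x| * r ≤ 1 / 2 := by
  have : Tendsto (fun x : ℝ => |x| * r) (𝓝 0) (𝓝 (|0| * r)) :=
    (continuous_abs.mul continuous_const).tendsto 0
  exact this.eventually_le_const (by simp)

theorem isBigO_source (hr : 0 < r) (hD : 0 ≤ D) (hf : ∀ k, |f (k + 2)| ≤ D * r ^ (k + 2)) (n : ℕ) :
    (fun x => ∑' k, f (k + 2) * x ^ (k + 2) - ∑ k ∈ range n, f (k + 2) * x ^ (k + 2))
      =O[𝓝 0] fun x => x ^ n := by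
  refine IsBigO.of_bound (D * (2 * r) ^ n * ∑' k : ℕ, (1 / 2 : ℝ) ^ (k + 2)) ?_
  filter_upwards [eventually_abs_mul_le r] with x hx
  have hw : Summable fun k : ℕ => (1 / 2 : ℝ) ^ (k + 2) :=
    (summable_nat_add_iff 2).2 (summable_geometric_of_lt_one (by norm_num) (by norm_num))
  have hx0 : 0 ≤ |x| * r := by positivity
  have hT : ∀ k, |f (k + 2) * x ^ (k + 2)| ≤ D * (|x| * r) ^ (k + 2) := fun k => by
    rw [abs_mul, abs_pow, mul_pow, mul_left_comm, mul_comm]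
    gcongr
    exact hf k
  have hn : ∀ m k, m ≤ k + 2 → |f (k + 2) * x ^ (k + 2)| ≤
      D * (2 * (|x| * r)) ^ m * (1 / 2) ^ (k + 2) := fun m k h => by
    rw [mul_assoc]
    exact (hT k).trans (mul_le_mul_of_nonneg_left (pow_le_two_mul_pow_mul hx0 hx h) hD)
  have := abs_tsum_sub_sum_le hw (hn 0 · (Nat.zero_le _)) (range n)
    (fun k hk => hn n k (by rw [mem_range] at hk; omega)) (by positivity) fun k => by positivity
  refine this.trans_eq ?_
  rw [Real.norm_eq_abs, abs_pow]
  ring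

theorem isBigO_interaction (hr : 0 < r) (hν : 0 ≤ ν)
    (hu : ∀ p l, |u (p + 1) (l + 2)| ≤ ν * r ^ (p + l + 3)) {m : ℝ → ℝ}
    (hm : ∀ᶠ x in 𝓝 (0 : ℝ), |m x| ≤ |x|) (n : ℕ) :
    (fun x => ∑' p : ℕ × ℕ, u (p.1 + 1) (p.2 + 2) * x ^ (p.1 + 1) * m x ^ (p.2 + 2) -
      ∑ p ∈ range n ×ˢ range n, u (p.1 + 1) (p.2 + 2) * x ^ (p.1 + 1) * m x ^ (p.2 + 2))
      =O[𝓝 0] fun x => x ^ n := by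
  refine IsBigO.of_bound
    (ν * (2 * r) ^ n * ∑' p : ℕ × ℕ, (1 / 2 : ℝ) ^ (p.1 + p.2 + 3)) ?_
  filter_upwards [eventually_abs_mul_le r, hm] with x hx hmx
  have hw : Summable fun p : ℕ × ℕ => (1 / 2 : ℝ) ^ (p.1 + p.2 + 3) := by
    have h1 : Summable fun k : ℕ => (1 / 2 : ℝ) ^ k :=
      summable_geometric_of_lt_one (by norm_num) (by norm_num)
    refine ((h1.mul_of_nonneg h1 (fun _ => by positivity) fun _ => by positivity).mul_right
      ((1 / 2 : ℝ) ^ 3)).congr fun p => ?_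
    rw [pow_add, pow_add]
  have hx0 : 0 ≤ |x| * r := by positivity
  have hT : ∀ p : ℕ × ℕ, |u (p.1 + 1) (p.2 + 2) * x ^ (p.1 + 1) * m x ^ (p.2 + 2)| ≤
      ν * (|x| * r) ^ (p.1 + p.2 + 3) := fun p => by
    rw [abs_mul, abs_mul, abs_pow, abs_pow]
    calc _ ≤ ν * r ^ (p.1 + p.2 + 3) * |x| ^ (p.1 + 1) * |x| ^ (p.2 + 2) := by
          gcongr
          exact hu _ _
      _ = _ := by ring
  have hn : ∀ m' (p : ℕ × ℕ), m' ≤ p.1 + p.2 + 3 →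
      |u (p.1 + 1) (p.2 + 2) * x ^ (p.1 + 1) * m x ^ (p.2 + 2)| ≤
      ν * (2 * (|x| * r)) ^ m' * (1 / 2) ^ (p.1 + p.2 + 3) := fun m' p h => by
    rw [mul_assoc ν]
    exact (hT p).trans (mul_le_mul_of_nonneg_left (pow_le_two_mul_pow_mul hx0 hx h) hν)
  have := abs_tsum_sub_sum_le hw (hn 0 · (Nat.zero_le _)) (range n ×ˢ range n)
    (fun p hp => hn n p (by simp only [mem_product, mem_range] at hp; omega)) (by positivity)
    fun p => by positivity
  refine this.trans_eq ?_
  rw [Real.norm_eq_abs, abs_pow]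
  ring

/-- Since `X ^ k * φ ^ l` has order at least `k + l`, terms with large indices do not affect the
coefficients below `n`; the index ranges may be enlarged or cut freely. -/
theorem X_pow_dvd_formalNonlinearity_sub (f : ℕ → ℝ) (u : ℕ → ℕ → ℝ) {φ : ℝ⟦X⟧}
    (hφ : PowerSeries.X ∣ φ) (n : ℕ) :
    PowerSeries.X ^ n ∣ formalNonlinearity f u φ -
      (∑ k ∈ range n, PowerSeries.C (f (k + 2)) * PowerSeries.X ^ (k + 2) +
        ∑ p ∈ range n ×ˢ range n, PowerSeries.C (u (p.1 + 1) (p.2 + 2)) *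
          PowerSeries.X ^ (p.1 + 1) * φ ^ (p.2 + 2)) := by
  refine PowerSeries.X_pow_dvd_iff.2 fun j hj => ?_
  have hvan : ∀ k l, j < k + l →
      PowerSeries.coeff j ((PowerSeries.X : ℝ⟦X⟧) ^ k * φ ^ l) = 0 := fun k l h => by
    refine (PowerSeries.X_pow_dvd_iff (n := k + l)).1 ?_ j h
    rw [pow_add]
    exact mul_dvd_mul_left _ (pow_dvd_pow_of_dvd hφ l)
  have h1 : ∑ k ∈ range n, PowerSeries.coeff j
      (PowerSeries.C (f (k + 2)) * (PowerSeries.X : ℝ⟦X⟧) ^ (k + 2)) =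
      if 2 ≤ j then f j else 0 := by
    simp only [PowerSeries.coeff_C_mul, PowerSeries.coeff_X_pow, mul_ite, mul_one, mul_zero]
    split_ifs with h2
    · obtain ⟨i, rfl⟩ := Nat.exists_eq_add_of_le' h2
      rw [sum_eq_single i (fun k _ hk => if_neg (by omega))
        fun hi => absurd (mem_range.2 (by omega)) hi, if_pos rfl]
    · exact sum_eq_zero fun k _ => if_neg (by omega)
  have h2 : ∑ k ∈ Icc 1 j, ∑ l ∈ Icc 2 j,
        u k l * PowerSeries.coeff j ((PowerSeries.X : ℝ⟦X⟧) ^ k * φ ^ l) =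
      ∑ p ∈ range n, ∑ l ∈ range n,
        u (p + 1) (l + 2) * PowerSeries.coeff j ((PowerSeries.X : ℝ⟦X⟧) ^ (p + 1) * φ ^ (l + 2)) := by
    have hl : ∀ k, ∑ l ∈ Icc 2 j,
        u k l * PowerSeries.coeff j ((PowerSeries.X : ℝ⟦X⟧) ^ k * φ ^ l) =
        ∑ l ∈ range n,
        u k (l + 2) * PowerSeries.coeff j ((PowerSeries.X : ℝ⟦X⟧) ^ k * φ ^ (l + 2)) := fun k => by
      rw [sum_subset (s₂ := Ico 2 (n + 2)) (fun l hl => by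
          simp only [mem_Icc, mem_Ico] at hl ⊢
          omega) fun l hl hl' => by
          simp only [mem_Icc, mem_Ico] at hl hl'
          rw [hvan k l (by omega), mul_zero], sum_Ico_eq_sum_range]
      simp [add_comm]
    simp only [hl]
    rw [sum_subset (s₂ := Ico 1 (n + 1)) (fun l hl => by
        simp only [mem_Icc, mem_Ico] at hl ⊢
        omega) fun k hk hk' => by
        simp only [mem_Icc, mem_Ico] at hk hk'
        refine sum_eq_zero fun l _ => ?_
        rw [hvan k _ (by omega), mul_zero], sum_Ico_eq_sum_range]
    simp [add_comm]
  rw [map_sub, map_add, map_sum, h1]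
  simp only [map_sum, mul_assoc, PowerSeries.coeff_C_mul, sum_product,
    formalNonlinearity, PowerSeries.coeff_mk, h2, sub_self]

theorem hasTaylor_nonlinearity (hr : 0 < r) (hD : 0 ≤ D) (hν : 0 ≤ ν)
    (hf : ∀ k, |f (k + 2)| ≤ D * r ^ (k + 2))
    (hu : ∀ p l, |u (p + 1) (l + 2)| ≤ ν * r ^ (p + l + 3)) {m : ℝ → ℝ}
    (hm : ∀ᶠ x in 𝓝 (0 : ℝ), |m x| ≤ |x|) {φ : ℝ⟦X⟧} (hX : PowerSeries.X ∣ φ) {n : ℕ}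
    (hφ : HasTaylor n m φ) :
    HasTaylor n (fun x => nonlinearity f u x (m x)) (formalNonlinearity f u φ) := by
  have h1 : HasTaylor n
      (fun x => ∑ k ∈ range n, f (k + 2) * x ^ (k + 2) + ∑ p ∈ range n ×ˢ range n,
        u (p.1 + 1) (p.2 + 2) * x ^ (p.1 + 1) * m x ^ (p.2 + 2)) _ :=
    (HasTaylor.sum _ fun k _ => (HasTaylor.const n _).mul ((HasTaylor.id n).pow _)).add
      (HasTaylor.sum _ fun p _ =>
        ((HasTaylor.const n _).mul ((HasTaylor.id n).pow _)).mul (hφ.pow _))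
  refine (h1.congr_series (X_pow_dvd_formalNonlinearity_sub f u hX n)).add_isBigO ?_
  refine ((isBigO_source hr hD hf n).add (isBigO_interaction hr hν hu hm n)).congr_left fun x => ?_
  rw [nonlinearity]
  ring

/-- The two sides of the invariance equation are the same function near `0`, and Taylor expansions
to all orders are unique. -/
theorem IsCenterManifold.isFormalCenterManifold {a : ℝ} {m : ℝ → ℝ}
    (h : IsCenterManifold a f u m) (hr : 0 < r) (hD : 0 ≤ D) (hν : 0 ≤ ν)
    (hf : ∀ k, |f (k + 2)| ≤ D * r ^ (k + 2))
    (hu : ∀ p l, |u (p + 1) (l + 2)| ≤ ν * r ^ (p + l + 3)) :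
    IsFormalCenterManifold a f u (taylorSeries m) := by
  have h0 : PowerSeries.coeff 0 (taylorSeries m) = 0 := by
    simp [taylorSeries, h.map_zero]
  -- Tangency to `y = 0` keeps the graph in the region where the double series is dominated by a
  -- geometric one.
  have hm : ∀ᶠ x in 𝓝 (0 : ℝ), |m x| ≤ |x| := by
    have hd : HasDerivAt m 0 0 := by
      have := (h.smooth.differentiableAt (by simp)).hasDerivAt
      rwa [h.deriv_zero] at this
    have := (hasDerivAt_iff_isLittleO.1 hd).bound one_pos
    filter_upwards [this] with x hx
    simpa [h.map_zero] using hx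
  have hd : ContDiffAt ℝ ∞ (deriv m) 0 :=
    (h.smooth.fderiv_right (m := ∞) (by simp)).clm_apply contDiffAt_const
  refine ⟨h0, by simp [taylorSeries, h.deriv_zero], ?_⟩
  have hφ := hasTaylor_taylorSeries h.smooth
  refine HasTaylor.unique (g := fun x => x ^ 2 * deriv m x + m x * (1 + a * x)) (fun n => ?_)
    fun n => ?_
  · rw [← taylorSeries_deriv]
    have h1 : HasTaylor n (fun x => 1 + a * x) (1 + PowerSeries.C a * PowerSeries.X) := by
      simpa using (HasTaylor.const n 1).add ((HasTaylor.const n a).mul (HasTaylor.id n))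
    exact (((HasTaylor.id n).pow 2).mul (hasTaylor_taylorSeries hd n)).add ((hφ n).mul h1)
  · refine (hasTaylor_nonlinearity hr hD hν hf hu hm
      (PowerSeries.X_dvd_iff.2 (by simpa using h0)) (hφ n)).congr ?_
    filter_upwards [h.invariant] with x hx
    rw [hx]
    ring

theorem exists_abs_coeff_taylorSeries_le {m : ℝ → ℝ} (hm : AnalyticAt ℝ m 0) :
    ∃ C R : ℝ, ∀ k, |PowerSeries.coeff k (taylorSeries m)| ≤ C * R ^ k := by
  obtain ⟨ρ, hρ⟩ := hm.hasFPowerSeriesAt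
  obtain ⟨q, hq0, hq⟩ := ENNReal.lt_iff_exists_nnreal_btwn.1 hρ.r_pos
  obtain ⟨C, -, hC⟩ := FormalMultilinearSeries.norm_mul_pow_le_of_lt_radius _
    (hq.trans_le hρ.r_le)
  have hq1 : 0 < (q : ℝ) := by exact_mod_cast hq0
  refine ⟨C, (q : ℝ)⁻¹, fun k => ?_⟩
  have := hC k
  rw [FormalMultilinearSeries.ofScalars_norm] at this
  rw [taylorSeries, PowerSeries.coeff_mk, inv_pow, ← div_eq_mul_inv, le_div_iff₀ (by positivity)]
  exact this

/-- By `le_norm_rise`, `Γ(K + 2 + a)` is at least `δ ^ K * K!` times `Γ(a + 2)`, which beats any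
geometric growth. -/
theorem tendsto_zero_of_abs_coeff_le {a C R : ℝ} (ha : 0 < a + 2) {c : ℕ → ℝ}
    (hc : ∀ k, |c k| ≤ C * R ^ k) :
    Tendsto (fun k : ℕ => (-1) ^ k / Real.Gamma (k + a) * c k) atTop (𝓝 0) := by
  rw [← tendsto_add_atTop_iff_nat 2]
  set δ := min 1 (a + 2)
  have hδ : 0 < δ := lt_min one_pos ha
  have hG := Real.Gamma_pos_of_pos ha
  have h1 := (FloorSemiring.tendsto_pow_div_factorial_atTop (R / δ)).const_mul
    (C * R ^ 2 / Real.Gamma (a + 2))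
  rw [mul_zero] at h1
  refine squeeze_zero_norm (fun K => ?_) h1
  have h2 : ((K + 2 : ℕ) : ℝ) + a = a + 2 + K := by
    push_cast
    ring
  have h3 : δ ^ K * K.factorial ≤ |rise (a + 2) K| := by
    have := le_norm_rise hδ (min_le_left _ _) (b := ((a + 2 : ℝ) : ℂ)) (min_le_right _ _) K
    rwa [← Complex.ofRealHom_eq_coe, ← map_rise, Complex.ofRealHom_eq_coe, Complex.norm_real] at this
  have h4 : 0 < δ ^ K * K.factorial := by positivity
  rw [h2, Gamma_add_natCast ha, norm_mul, norm_div, norm_mul, norm_pow, norm_neg, norm_one, one_pow,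
    Real.norm_of_nonneg hG.le, Real.norm_eq_abs, Real.norm_eq_abs]
  calc 1 / (|rise (a + 2) K| * Real.Gamma (a + 2)) * |c (K + 2)|
      ≤ 1 / (δ ^ K * K.factorial * Real.Gamma (a + 2)) * (C * R ^ (K + 2)) := by
        gcongr
        exact hc _
    _ = _ := by
        rw [div_pow]
        field_simp
        ring

end CenterManifold

/-! ### Admissible systems satisfy the a priori hypotheses -/

namespace Admissible

variable {ρ B : ℝ} {f : ℕ → ℝ} {h : ℕ → ℕ → ℝ}

theorem abs_f_le (hA : Admissible ρ B f h) (K : ℕ) : |f (K + 2)| ≤ B * ρ⁻¹ ^ (K + 2) := by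
  rw [inv_pow]
  exact hA.f_bound _ (by omega)

theorem abs_mul_h_le (hA : Admissible ρ B f h) {μ : ℝ} (hμ : 0 ≤ μ) (p l : ℕ) :
    |μ * h (p + 1) (l + 2)| ≤ μ * ρ⁻¹ ^ (p + l + 3) := by
  rw [abs_mul, abs_of_nonneg hμ, inv_pow, show p + l + 3 = p + 1 + (l + 2) by ring]
  exact mul_le_mul_of_nonneg_left (hA.h_bound _ _ (by omega) (by omega)) hμ

variable {δ μ a : ℝ}

theorem controlled_update (hA : Admissible ρ B f h) (hδ : 0 < δ) (hδ1 : δ ≤ 1) (hρ : 0 < ρ)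
    (hB : 0 ≤ B) (hμ : 0 ≤ μ) (hμ' : μ ≤ couplingBound δ ρ⁻¹ B) (ha : δ ≤ a + 2) {z : ℂ}
    (hz : ‖z‖ ≤ (B + 1) * ρ⁻¹ ^ 2) :
    Controlled δ ρ⁻¹ (B + 1) μ ((a : ℂ) + 2) (Function.update (fun k => (f k : ℂ)) 2 z)
      (fun k l => ((μ * h k l : ℝ) : ℂ)) := by
  have hr : 0 < ρ⁻¹ := inv_pos.2 hρ
  have := couplingBound_pos hδ hr hB
  refine controlled_of_le hδ hδ1 hr hB hμ (by linarith) (by simpa using ha) (fun K => ?_)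
    fun p l => ?_
  · cases K with
    | zero => simpa using hz
    | succ K =>
      rw [Function.update_of_ne (by omega), Complex.norm_real, Real.norm_eq_abs]
      refine (hA.abs_f_le _).trans ?_
      gcongr
      linarith
  · rw [Complex.norm_real, Real.norm_eq_abs]
    exact hA.abs_mul_h_le hμ p l

theorem controlled (hA : Admissible ρ B f h) (hδ : 0 < δ) (hδ1 : δ ≤ 1) (hρ : 0 < ρ)
    (hB : 0 ≤ B) (hμ : 0 ≤ μ) (hμ' : μ ≤ couplingBound δ ρ⁻¹ B) (ha : δ ≤ a + 2) :
    Controlled δ ρ⁻¹ (B + 1) μ ((a : ℂ) + 2) (fun k => (f k : ℂ))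
      (fun k l => ((μ * h k l : ℝ) : ℂ)) := by
  have hz : ‖(f 2 : ℂ)‖ ≤ (B + 1) * ρ⁻¹ ^ 2 := by
    rw [Complex.norm_real, Real.norm_eq_abs]
    refine (hA.abs_f_le 0).trans ?_
    gcongr
    linarith
  simpa using hA.controlled_update hδ hδ1 hρ hB hμ hμ' ha hz

end Admissible

theorem exists_inv_Gamma_le {α : ℝ} (hα : -2 < α) (β : ℝ) :
    ∃ G : ℝ, ∀ a ∈ Set.Icc α β, (Real.Gamma (a + 2))⁻¹ ≤ G := by
  have hc : ContinuousOn (fun a => (Real.Gamma (a + 2))⁻¹) (Set.Icc α β) := by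
    intro a ha
    have ha2 : 0 < a + 2 := by linarith [ha.1]
    refine ContinuousAt.continuousWithinAt (ContinuousAt.inv₀ ?_ (Real.Gamma_pos_of_pos ha2).ne')
    refine ContinuousAt.comp (g := Real.Gamma) (f := fun a => a + 2) ?_ (by fun_prop)
    refine (Real.differentiableAt_Gamma fun m hm => ?_).continuousAt
    linarith [(Nat.cast_nonneg m : (0 : ℝ) ≤ m)]
  obtain ⟨G, hG⟩ := (isCompact_Icc.image_of_continuousOn hc).bddAbove
  exact ⟨G, fun a ha => hG ⟨a, ha, rfl⟩⟩

end

end SaddleNode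

/-! ### The main theorem -/

theorem mainTheorem2 (α β ρ B c d : ℝ) (hα : -2 < α) (hαβ : α < β) (hρ : 0 < ρ)
    (hcd : c < d) (hI : ∀ t ∈ Set.Icc c d, |t| ≤ B * (ρ ^ 2)⁻¹) :
    ∃ (μ₀ K : ℝ) (S : ℝ → (ℕ → ℝ) → (ℕ → ℕ → ℝ) → ℝ), 0 < μ₀ ∧
      (∀ a ∈ Set.Icc α β, ∀ μ ∈ Set.Ico 0 μ₀, ∀ (f : ℕ → ℝ) (h : ℕ → ℕ → ℝ),
        SaddleNode.Admissible ρ B f h →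
        -- the formal expansion exists, is unique, and its coefficients have the stated growth
        (∃ φ : PowerSeries ℝ,
          SaddleNode.IsFormalCenterManifold a f (fun k l => μ * h k l) φ ∧
          (∀ ψ : PowerSeries ℝ,
            SaddleNode.IsFormalCenterManifold a f (fun k l => μ * h k l) ψ → ψ = φ) ∧
          Filter.Tendsto (fun k : ℕ => (-1) ^ k / Real.Gamma (k + a) * PowerSeries.coeff k φ)
            Filter.atTop (nhds (S a f (fun k l => μ * h k l)))) ∧
        -- the Taylor coefficients of the center manifold, and its nonanalyticity
        (∀ m : ℝ → ℝ, SaddleNode.IsCenterManifold a f (fun k l => μ * h k l) m →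
          Filter.Tendsto
            (fun k : ℕ => (-1) ^ k / Real.Gamma (k + a) * (1 / (k.factorial : ℝ)) *
              iteratedDeriv k m 0)
            Filter.atTop (nhds (S a f (fun k l => μ * h k l))) ∧
          (S a f (fun k l => μ * h k l) ≠ 0 → ¬ AnalyticAt ℝ m 0)) ∧
        -- dependence on the coefficient of `x ^ 2`
        ContDiffOn ℝ 1 (fun t => S a (Function.update f 2 t) (fun k l => μ * h k l))
          (Set.Icc c d) ∧
        ∀ t ∈ Set.Icc c d,
          |derivWithin (fun s => S a (Function.update f 2 s) (fun k l => μ * h k l))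
              (Set.Icc c d) t - 1 / Real.Gamma (2 + a)| ≤ K * μ ∧
          derivWithin (fun s => S a (Function.update f 2 s) (fun k l => μ * h k l))
              (Set.Icc c d) t ≠ 0) ∧
      -- joint `C^1` dependence on all the parameters
      ContDiffOn ℝ 1
        (fun p : SaddleNode.Parameters =>
          S p.1 (fun k => p.2.2.1 k * (ρ ^ k)⁻¹)
            (fun k l => p.2.1 * (p.2.2.2 (k, l) * (ρ ^ (k + l))⁻¹)))
        (Set.Icc α β ×ˢ Set.Ico 0 μ₀ ×ˢ Metric.closedBall 0 B ×ˢ Metric.closedBall 0 1) := by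
  have hr : 0 < ρ⁻¹ := inv_pos.2 hρ
  have hr2 : 0 < ρ⁻¹ ^ 2 := by positivity
  have hI' : ∀ t ∈ Set.Icc c d, |t| ≤ B * ρ⁻¹ ^ 2 := fun t ht => by
    rw [inv_pow]
    exact hI t ht
  have hB : 0 ≤ B :=
    nonneg_of_mul_nonneg_left ((abs_nonneg c).trans (hI' c (Set.left_mem_Icc.2 hcd.le))) hr2
  -- The inequality `δ < α + 2` is strict so that the real parameters lie in an open complex domain.
  obtain ⟨δ, hδ, hδ1, hδα⟩ : ∃ δ : ℝ, 0 < δ ∧ δ ≤ 1 ∧ δ < α + 2 :=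
    ⟨min 1 ((α + 2) / 2), lt_min one_pos (by linarith), min_le_left _ _,
      (min_le_right _ _).trans_lt (by linarith)⟩
  obtain ⟨G, hG⟩ := SaddleNode.exists_inv_Gamma_le hα β
  set C := SaddleNode.couplingConst δ ρ⁻¹ B with hC
  have hCpos : 0 < C := SaddleNode.couplingConst_pos hδ hr hB
  -- The constant `K` is the bound `G` for `1 / Γ(a + 2)` times the Cauchy bound for the derivative
  -- of the nonlinear part per unit of `μ`.
  refine ⟨SaddleNode.couplingBound δ ρ⁻¹ B, G * (2 * C / ρ⁻¹ ^ 2), SaddleNode.leadingCoeff,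
    SaddleNode.couplingBound_pos hδ hr hB, ?_, ?_⟩
  · intro a ha μ hμ f h hA
    have haδ : δ ≤ a + 2 := by linarith [ha.1]
    have ha2 : 0 < a + 2 := hδ.trans_le haδ
    have hΓ : 0 < (Real.Gamma (a + 2))⁻¹ := inv_pos.2 (Real.Gamma_pos_of_pos ha2)
    have hlim := (hA.controlled hδ hδ1 hρ hB hμ.1 hμ.2.le haδ).tendsto_leadingCoeff
    have hupd : ∀ z ∈ Metric.ball (0 : ℂ) ((B + 1) * ρ⁻¹ ^ 2), _ := fun z hz =>
      hA.controlled_update hδ hδ1 hρ hB hμ.1 hμ.2.le haδ (mem_ball_zero_iff.1 hz).le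
    refine ⟨⟨_, (SaddleNode.isFormalCenterManifold_iff a f _ _).2 rfl,
      fun ψ => (SaddleNode.isFormalCenterManifold_iff a f _ ψ).1, hlim⟩, fun m hm => ?_,
      SaddleNode.contDiffOn_leadingCoeff_update hI' hr hupd, fun t ht => ?_⟩
    · have hformal := hm.isFormalCenterManifold hr hB hμ.1 hA.abs_f_le (hA.abs_mul_h_le hμ.1)
      rw [← (SaddleNode.isFormalCenterManifold_iff a f _ _).1 hformal] at hlim
      refine ⟨hlim.congr fun k => ?_, fun hS han => hS ?_⟩
      · rw [SaddleNode.taylorSeries, PowerSeries.coeff_mk]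
        ring
      · obtain ⟨C, R, hCR⟩ := SaddleNode.exists_abs_coeff_taylorSeries_le han
        exact tendsto_nhds_unique hlim (SaddleNode.tendsto_zero_of_abs_coeff_le ha2 hCR)
    · rw [SaddleNode.derivWithin_leadingCoeff_update hI' hr hupd (uniqueDiffOn_Icc hcd) ht]
      have hbound := (Complex.abs_re_le_norm _).trans
        (SaddleNode.norm_deriv_nonlinearPart_le hr hupd (z := (t : ℂ))
          (by simpa only [Complex.norm_real, Real.norm_eq_abs] using hI' t ht))
      rw [← hC] at hbound
      set D := (deriv (SaddleNode.nonlinearPart a f fun k l => μ * h k l) (t : ℂ)).re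
      -- The derivative of `S` is `(1 + D) / Γ(a + 2)`, so this gives its positivity.
      have hD1 : |D| < 1 := by
        refine hbound.trans_lt ?_
        rw [div_lt_one hr2]
        refine lt_of_lt_of_le ?_ (SaddleNode.couplingBound_mul_le_sq hδ hr hB)
        rw [← hC, mul_assoc]
        have := hμ.2
        gcongr
      refine ⟨?_, mul_ne_zero hΓ.ne' (by linarith [(abs_lt.1 hD1).1] : 0 < 1 + D).ne'⟩
      rw [add_comm 2 a, one_div, mul_add, mul_one, add_sub_cancel_left, abs_mul, abs_of_pos hΓ]
      calc _ ≤ G * (2 * (μ * C) / ρ⁻¹ ^ 2) :=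
            mul_le_mul (hG a ha) hbound (abs_nonneg _) (hΓ.le.trans (hG a ha))
        _ = _ := by ring
  · simpa only [inv_pow] using SaddleNode.contDiffOn_leadingCoeff (β := β) hδ hδ1 hδα hr hB
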